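/- Let $G$ be a graph and $S\subseteq V(G)$ a set of detectors; a detector at $w$ fires when an intruder is in the open neighbourhood $N(w)$. The set $S$ is an error-correcting open-locating-dominating (ERR:OLD) set if the presence and the location of an intruder are determined by the set of firing detectors even when at most one detector reports wrongly (a false positive or a false negative); equivalently, $|N(v)\cap S|\ge 3$ for every vertex $v$, and $|(N(u)\cap S)\,\triangle\,(N(v)\cap S)|\ge 3$ for all distinct vertices $u,v$. For a locally finite infinite graph $G$ and a base vertex $v$, the density of $S\subseteq V(G)$ is $$\limsup_{r\to\infty}\frac{|S\cap B_r(v)|}{|B_r(v)|},\qquad B_r(v)=\{u: d(u,v)\le r\},$$ and $\mathrm{ERR{:}OLD\%}(G)$ is the smallest density (infimum) of an ERR:OLD set of $G$. Let SQR, TRI and KNG be the infinite square, triangular and king grids: the graphs on $\mathbb Z^2$ in which two vertices are adjacent when their difference is in $\{(\pm1,0),(0,\pm1)\}$, in $\{(\pm1,0),(0,\pm1),(1,-1),(-1,1)\}$, and in $\{-1,0,1\}^2\setminus\{(0,0)\}$, respectively. **Theorem.** For every choice of the base vertex, 1. $\frac{6}{7}\le \mathrm{ERR{:}OLD\%}(\mathrm{SQR})\le\frac{7}{8}$;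 2. $\frac{6}{11}\le \mathrm{ERR{:}OLD\%}(\mathrm{TRI})\le\frac{4}{7}$; 3. $\frac{36}{83}\le \mathrm{ERR{:}OLD\%}(\mathrm{KNG})\le\frac{4}{9}$; and in each grid there is an ERR:OLD set whose density equals the stated upper bound. -/

import Mathlib

open Filter

namespace ErrOld

/-- The signal that a fully functioning set `S` of detectors produces.  A detector at `w` fires
exactly when the intruder is at a neighbour of `w` (never because the intruder is at `w`), so an
intruder at `v` makes the detectors in `N(v) ∩ S` fire; `none` means that there is no intruder. -/
def signal {V : Type*} (G : SimpleGraph V) (S : Set V) : Option V → Set V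
  | none => ∅
  | some v => G.neighborSet v ∩ S

/-- `S` is an error-correcting open-locating-dominating (ERR:OLD) set of `G`: whatever set
`R ⊆ S` of detectors is seen firing, at most one state (no intruder, or an intruder at a certain
vertex) is compatible with `R` under the assumption that at most one detector reports wrongly
(a false positive is an element of `R \ signal`, a false negative one of `signal \ R`). -/
def IsErrOld {V : Type*} (G : SimpleGraph V) (S : Set V) : Prop :=
  ∀ R ⊆ S, ∀ x y : Option V,
    (symmDiff R (signal G S x)).encard ≤ 1 → (symmDiff R (signal G S y)).encard ≤ 1 → x = y

theorem exists_report_iff {V : Type*} {S A B : Set V} (hA : A ⊆ S) (hB : B ⊆ S) :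
    (∃ R ⊆ S, (symmDiff R A).encard ≤ 1 ∧ (symmDiff R B).encard ≤ 1) ↔
      ¬ 3 ≤ (symmDiff A B).encard := by
  constructor
  · rintro ⟨R, -, h1, h2⟩ h3
    have hsub : symmDiff A B ⊆ symmDiff R A ∪ symmDiff R B := by
      intro w
      simp only [Set.mem_symmDiff, Set.mem_union]
      tauto
    have h4 : (symmDiff A B).encard ≤ 1 + 1 :=
      ((Set.encard_le_encard hsub).trans (Set.encard_union_le _ _)).trans (add_le_add h1 h2)
    have h5 : (3 : ℕ∞) ≤ 1 + 1 := h3.trans h4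
    exact absurd h5 (by decide)
  · intro h
    rcases Set.eq_empty_or_nonempty (symmDiff A B) with h0 | ⟨w, hw⟩
    · refine ⟨A, hA, by simp, by simp [h0]⟩
    · have hwS : w ∈ S := by
        rcases hw with hw | hw
        · exact hA hw.1
        · exact hB hw.1
      have hle : (symmDiff A B).encard ≤ 2 := by
        have h6 : (symmDiff A B).encard < 2 + 1 := by
          rw [not_le] at h
          exact h.trans_eq (by norm_num)
        exact Order.le_of_lt_add_one h6
      refine ⟨symmDiff A {w}, ?_, ?_, ?_⟩
      · intro z hz
        rcases hz with hz | hz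
        · exact hA hz.1
        · rw [Set.mem_singleton_iff.1 hz.1]
          exact hwS
      · have h7 : symmDiff (symmDiff A {w}) A = {w} := by
          rw [symmDiff_comm, ← symmDiff_assoc, symmDiff_self, bot_symmDiff]
        rw [h7, Set.encard_singleton]
      · have h8 : symmDiff (symmDiff A {w}) B = symmDiff A B \ {w} := by
          ext z
          by_cases hz : z = w
          · subst hz
            simp only [Set.mem_symmDiff, Set.mem_sdiff, Set.mem_singleton_iff] at hw ⊢
            tauto
          · simp only [Set.mem_symmDiff, Set.mem_sdiff, Set.mem_singleton_iff]
            tauto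
        rw [h8]
        have h9 := Set.encard_sdiff_singleton_add_one hw
        have h10 : (symmDiff A B \ {w}).encard + 1 ≤ 1 + 1 := by
          rw [h9]
          exact hle.trans_eq (by norm_num)
        exact (ENat.add_le_add_iff_right (by simp)).1 h10

/-- The usual description of ERR:OLD sets: every vertex is at least 3-open-dominated and every
two distinct vertices are 3-distinguished. -/
theorem isErrOld_iff {V : Type*} (G : SimpleGraph V) (S : Set V) :
    IsErrOld G S ↔
      (∀ v, 3 ≤ (G.neighborSet v ∩ S).encard) ∧
      (∀ u v, u ≠ v → 3 ≤ (symmDiff (G.neighborSet u ∩ S) (G.neighborSet v ∩ S)).encard) := by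
  have hsub : ∀ x, signal G S x ⊆ S := by
    rintro (_ | v)
    · exact Set.empty_subset _
    · exact Set.inter_subset_right
  have key : IsErrOld G S ↔
      ∀ x y, x ≠ y → 3 ≤ (symmDiff (signal G S x) (signal G S y)).encard := by
    constructor
    · intro h x y hxy
      by_contra h3
      obtain ⟨R, hR, h1, h2⟩ := (exists_report_iff (hsub x) (hsub y)).2 h3
      exact hxy (h R hR x y h1 h2)
    · intro h R hR x y h1 h2
      by_contra hxy
      exact (exists_report_iff (hsub x) (hsub y)).1 ⟨R, hR, h1, h2⟩ (h x y hxy)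
  rw [key]
  constructor
  · intro h
    refine ⟨fun v => ?_, fun u v huv => ?_⟩
    · have h1 := h (some v) none (by simp)
      have h2 : symmDiff (signal G S (some v)) (signal G S none) = G.neighborSet v ∩ S :=
        symmDiff_bot _
      rwa [h2] at h1
    · exact h (some u) (some v) (by simpa using huv)
  · rintro ⟨h1, h2⟩ (_ | u) (_ | v) hxy
    · exact absurd rfl hxy
    · have h3 : symmDiff (signal G S none) (signal G S (some v)) = G.neighborSet v ∩ S :=
        bot_symmDiff _
      rw [h3]
      exact h1 v
    · have h3 : symmDiff (signal G S (some u)) (signal G S none) = G.neighborSet u ∩ S :=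
        symmDiff_bot _
      rw [h3]
      exact h1 u
    · exact h2 u v (by simpa using hxy)

/-- The closed ball of radius `r` around `v` in the graph metric. -/
def ball {V : Type*} (G : SimpleGraph V) (v : V) (r : ℕ) : Set V :=
  {u | G.edist v u ≤ (r : ℕ∞)}

/-- The (upper) density of `S` in a locally finite graph `G`, measured on the balls around `v`:
`limsup_{r → ∞} |S ∩ B_r(v)| / |B_r(v)|`. -/
noncomputable def density {V : Type*} (G : SimpleGraph V) (v : V) (S : Set V) : ℝ :=
  limsup (fun r : ℕ => ((S ∩ ball G v r).ncard : ℝ) / ((ball G v r).ncard : ℝ)) atTop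

/-- `ERR:OLD%(G)`: the smallest (infimum) density of an ERR:OLD set of `G`, densities being
measured on the balls around `v`. -/
noncomputable def errOldPercent {V : Type*} (G : SimpleGraph V) (v : V) : ℝ :=
  sInf {d : ℝ | ∃ S : Set V, IsErrOld G S ∧ density G v S = d}

/-- The infinite square grid. -/
def SQR : SimpleGraph (ℤ × ℤ) where
  Adj p q := |q.1 - p.1| + |q.2 - p.2| = 1
  symm := ⟨fun p q h => by rwa [abs_sub_comm p.1, abs_sub_comm p.2]⟩
  loopless := ⟨fun p h => by simp at h⟩

/-- The infinite triangular grid: the square grid together with one of the two diagonals in every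
unit square, the one in direction `(1, -1)`. -/
def TRI : SimpleGraph (ℤ × ℤ) where
  Adj p q := |q.1 - p.1| + |q.2 - p.2| = 1 ∨
    (q.1 - p.1 = 1 ∧ q.2 - p.2 = -1) ∨ (q.1 - p.1 = -1 ∧ q.2 - p.2 = 1)
  symm := ⟨fun p q h => by
    rw [abs_sub_comm p.1, abs_sub_comm p.2]
    rcases h with h | h | h
    · exact Or.inl h
    · exact Or.inr (Or.inr (by omega))
    · exact Or.inr (Or.inl (by omega))⟩
  loopless := ⟨fun p h => by simp at h⟩

/-- The infinite king grid: the square grid together with both diagonals in every unit square. -/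
def KNG : SimpleGraph (ℤ × ℤ) where
  Adj p q := p ≠ q ∧ |q.1 - p.1| ≤ 1 ∧ |q.2 - p.2| ≤ 1
  symm := ⟨fun p q h => by
    rw [abs_sub_comm p.1, abs_sub_comm p.2]
    exact ⟨h.1.symm, h.2⟩⟩
  loopless := ⟨fun p h => h.1 rfl⟩

end ErrOld

/-!
Counting detectors in balls gives all six bounds.

*Balls.* The graph distance of each grid is given by a norm on `ℤ × ℤ` with integer values (`ℓ¹`,
hexagonal, `ℓ∞`). The sphere of radius `n` lies on at most six segments of `2 n + 1` cells, and the
ball of radius `r` contains at least a fixed multiple of `(r + 1) ^ 2` cells. So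
`|B_r(v)| / |B_{r+c}(v)| → 1` for each constant `c`, and inequalities that compare `B_r` with
`B_{r+c}` pass to the density. This is packaged in `GridNorm`.

*Discharging.* Suppose that every vertex `u` sends the weight `f i u` to `u + t i`, that it sends at
least `a` in total, and that every detector receives at most `b` and every other vertex nothing.
Then `a |B_r| ≤ b |S ∩ B_{r+c}|`, where `c` bounds the norm of the `t i` (`GridNorm.discharging`),
and the density of `S` is at least `a / b`. Applied to a periodic set and to its complement, with
the `t i` running through a period, the same lemma computes the density of that set
(`GridNorm.density_of_periodic`).

*Upper bounds.* There are periodic error-correcting open-locating-dominating sets of periods 8, 7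
and 6; only finitely many conditions modulo the period have to be checked.

*Square grid.* Among the seven cells of `sqrTile` no two can both be without a detector: any two of
them lie in a neighbourhood of four cells, or in a symmetric difference of two neighbourhoods which
consists of four cells, and such a set contains at least three detectors. Each translate of the tile
thus contains at least six detectors.

*Triangular grid.* A vertex sends 4 to each neighbouring detector if it has exactly three of them
and 3 otherwise, at least 12 in total. Two vertices with exactly three detectors have at most one
of them in common. This excludes five consecutive neighbours of a detector with exactly three
detectors each, so a detector receives at most `4 * 4 + 2 * 3 = 22`.

*King grid.* A vertex with `k` neighbouring detectors sends `180 / k` units to each of them for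
`k ≤ 5` and 30 for `k ≥ 6`, except that for three arrangements of the detectors, up to symmetry, the
180 units are divided unevenly (`kngShare`). So it sends at least 180, and the claim is that a
detector receives at most 415. What the detector at the centre of a `5 × 5` square receives depends
on this square only, and `search` decides the claim by branch and bound over the other 24 cells. A
branch is left if one of 45 conditions on the square (nine neighbourhoods and their 36 symmetric
differences contain at least three detectors each) can no longer be satisfied, or if the cells fixed
so far already force the bound. All counters of a search node are the bytes of one natural number,
so that they are updated and tested by a few operations on numbers. `search_eq_true` is the
evaluation of the search in the kernel, and `search_sound` says what it proves.
-/

namespace ErrOld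
open Finset Topology

/-! ### Balls and discharging in grids with an integer norm -/

/-- A subadditive function `ν` on `ℤ × ℤ` with natural values such that the graph distance of `u`
and `w` in `G` is `ν (w - u)`, together with bounds for its balls and spheres. Symmetry of `ν` is
not needed. -/
structure GridNorm (G : SimpleGraph (ℤ × ℤ)) (ν : ℤ × ℤ → ℕ) : Prop where
  zero : ν 0 = 0
  eq_zero : ∀ p, ν p = 0 → p = 0
  add_le : ∀ p q, ν (p + q) ≤ ν p + ν q
  adj_iff : ∀ p q, G.Adj p q ↔ ν (q - p) = 1
  /-- A vertex at distance `n + 1` has a neighbour at distance `n`. -/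
  step : ∀ p n, ν p = n + 1 → ∃ q, ν q = 1 ∧ ν (p - q) = n
  /-- The ball of radius `i + j` contains `(i, j)`; hence balls grow quadratically. -/
  quadrant : ∀ i j : ℕ, ν (i, j) ≤ i + j
  /-- The sphere of radius `n` is covered by six families of `2 n + 1` points. -/
  sphere : ∃ f : Fin 6 → ℕ → ℤ → ℤ × ℤ,
    ∀ p, ∃ k, ∃ t ∈ Finset.Icc (-(ν p : ℤ)) (ν p), f k (ν p) t = p

namespace GridNorm

variable {G : SimpleGraph (ℤ × ℤ)} {ν : ℤ × ℤ → ℕ}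

theorem norm_le_length (h : GridNorm G ν) {u w : ℤ × ℤ} (p : G.Walk u w) :
    ν (w - u) ≤ p.length := by
  induction p with
  | nil => simp [h.zero]
  | @cons a b c hab p ih =>
    have h1 := h.add_le (c - b) (b - a)
    rw [sub_add_sub_cancel, (h.adj_iff a b).1 hab] at h1
    rw [SimpleGraph.Walk.length_cons]
    omega

theorem edist_le_norm (h : GridNorm G ν) (n : ℕ) :
    ∀ u w : ℤ × ℤ, ν (w - u) = n → G.edist u w ≤ n := by
  induction n with
  | zero =>
    intro u w huw
    rw [← sub_eq_zero.1 (h.eq_zero _ huw), SimpleGraph.edist_self]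
    simp
  | succ n ih =>
    intro u w huw
    obtain ⟨q, hq1, hq2⟩ := h.step _ _ huw
    have h1 : G.Adj u (u + q) := (h.adj_iff _ _).2 (by simpa using hq1)
    have h2 := ih (u + q) w (by rw [← hq2]; congr 1; abel)
    calc G.edist u w ≤ G.edist u (u + q) + G.edist (u + q) w := SimpleGraph.edist_triangle
      _ ≤ 1 + n := add_le_add (SimpleGraph.edist_eq_one_iff_adj.2 h1).le h2
      _ = ((n + 1 : ℕ) : ℕ∞) := by push_cast; rw [add_comm]

theorem mem_ball (h : GridNorm G ν) {v u : ℤ × ℤ} {r : ℕ} :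
    u ∈ ball G v r ↔ ν (u - v) ≤ r := by
  constructor
  · intro hu
    have hu' : G.edist v u ≤ (r : ℕ∞) := hu
    obtain ⟨p, hp⟩ := SimpleGraph.exists_walk_of_edist_ne_top
      (ne_top_of_le_ne_top (ENat.natCast_ne_top r) hu')
    rw [← hp] at hu'
    exact (h.norm_le_length p).trans (by exact_mod_cast hu')
  · intro hu
    exact (h.edist_le_norm _ v u rfl).trans (by exact_mod_cast hu)

/-- The balls of `ν` as finsets, and a linear bound for the growth of their size. The bound for the
size of the sphere comes from the six families of `GridNorm.sphere`. -/
theorem exists_ball_finset (h : GridNorm G ν) (v : ℤ × ℤ) :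
    ∃ B : ℕ → Finset (ℤ × ℤ), (∀ r u, u ∈ B r ↔ ν (u - v) ≤ r) ∧
      ∀ r, #(B (r + 1)) ≤ #(B r) + 6 * (2 * r + 3) := by
  obtain ⟨f, hf⟩ := h.sphere
  let P : ℕ → Finset (ℤ × ℤ) := fun n =>
    (univ ×ˢ Finset.Icc (-(n : ℤ)) n).image fun q : Fin 6 × ℤ => v + f q.1 n q.2
  have hP : ∀ u, u ∈ P (ν (u - v)) := by
    intro u
    obtain ⟨k, t, ht, hk⟩ := hf (u - v)
    exact Finset.mem_image.2 ⟨(k, t), by simpa using ht, by rw [hk]; abel⟩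
  let B : ℕ → Finset (ℤ × ℤ) := fun r => ((range (r + 1)).biUnion P).filter fun u => ν (u - v) ≤ r
  have hB : ∀ r u, u ∈ B r ↔ ν (u - v) ≤ r := by
    intro r u
    simp only [B, Finset.mem_filter, Finset.mem_biUnion, and_iff_right_iff_imp]
    exact fun hu => ⟨_, by simpa [Nat.lt_succ_iff] using hu, hP u⟩
  refine ⟨B, hB, fun r => ?_⟩
  have hsub : B (r + 1) ⊆ B r ∪ P (r + 1) := by
    intro u hu
    rw [hB] at hu
    rcases Nat.lt_or_ge (ν (u - v)) (r + 1) with h1 | h1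
    · exact Finset.mem_union_left _ ((hB r u).2 (by omega))
    · have h2 := hP u
      rw [le_antisymm hu h1] at h2
      exact Finset.mem_union_right _ h2
  refine (Finset.card_le_card hsub).trans ((Finset.card_union_le _ _).trans ?_)
  refine Nat.add_le_add_left (Finset.card_image_le.trans ?_) _
  rw [Finset.card_product, Int.card_Icc, Finset.card_univ, Fintype.card_fin]
  push_cast
  omega

theorem ball_finite (h : GridNorm G ν) (v : ℤ × ℤ) (r : ℕ) : (ball G v r).Finite := by
  obtain ⟨B, hB, -⟩ := h.exists_ball_finset v
  exact (B r).finite_toSet.subset fun u hu => (hB r u).2 (h.mem_ball.1 hu)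

theorem ncard_ball_succ_le (h : GridNorm G ν) (v : ℤ × ℤ) (r : ℕ) :
    (ball G v (r + 1)).ncard ≤ (ball G v r).ncard + 6 * (2 * r + 3) := by
  obtain ⟨B, hB, hc⟩ := h.exists_ball_finset v
  have : ∀ r, ball G v r = ↑(B r) := fun r => Set.ext fun u => by
    rw [h.mem_ball, Finset.mem_coe, hB]
  rw [this, this, Set.ncard_coe_finset, Set.ncard_coe_finset]
  exact hc r

theorem ball_subset_ball (h : GridNorm G ν) (v : ℤ × ℤ) {r s : ℕ} (hrs : r ≤ s) :
    ball G v r ⊆ ball G v s := fun _ hu => h.mem_ball.2 ((h.mem_ball.1 hu).trans hrs)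

/-- A ball of radius `r` contains a square of side `r / 2 + 1`. -/
theorem le_ncard_ball (h : GridNorm G ν) (v : ℤ × ℤ) (r : ℕ) :
    (r + 1) ^ 2 ≤ 4 * (ball G v r).ncard := by
  have h1 : (r / 2 + 1) * (r / 2 + 1) ≤ (ball G v r).ncard := by
    have h2 : (((range (r / 2 + 1) ×ˢ range (r / 2 + 1)).image
        fun q : ℕ × ℕ => v + ((q.1 : ℤ), (q.2 : ℤ)) : Finset (ℤ × ℤ)) : Set (ℤ × ℤ)) ⊆
        ball G v r := by
      intro u hu
      obtain ⟨q, hq, rfl⟩ := Finset.mem_image.1 (Finset.mem_coe.1 hu)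
      have := h.quadrant q.1 q.2
      rw [Finset.mem_product, Finset.mem_range, Finset.mem_range] at hq
      rw [h.mem_ball, add_sub_cancel_left]
      omega
    have h3 := Set.ncard_le_ncard h2 (h.ball_finite v r)
    rwa [Set.ncard_coe_finset, Finset.card_image_of_injective, Finset.card_product,
      Finset.card_range] at h3
    rintro ⟨a, b⟩ ⟨c, d⟩ hq
    simpa using hq
  have h2 : r + 1 ≤ 2 * (r / 2 + 1) := by omega
  nlinarith

theorem ncard_ball_pos (h : GridNorm G ν) (v : ℤ × ℤ) (r : ℕ) : 0 < (ball G v r).ncard := by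
  have := h.le_ncard_ball v r
  have : 0 < (r + 1) ^ 2 := by positivity
  omega

/-- Balls have quadratic size and linear boundary, so enlarging the radius by a constant does not
change their size asymptotically. -/
theorem tendsto_ncard_ball_ratio (h : GridNorm G ν) (v : ℤ × ℤ) (c : ℕ) :
    Tendsto (fun r : ℕ => ((ball G v r).ncard : ℝ) / (ball G v (r + c)).ncard) atTop (𝓝 1) := by
  have hgrow : ∀ r, ((ball G v (r + c)).ncard : ℝ) ≤
      (ball G v r).ncard + c * (12 * (r + c + 1)) := by
    intro r
    induction c with
    | zero => simp
    | succ c ih =>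
      have h1 : ((ball G v (r + c + 1)).ncard : ℝ) ≤
          (ball G v (r + c)).ncard + 6 * (2 * (r + c) + 3) := by
        exact_mod_cast h.ncard_ball_succ_le v (r + c)
      have hc : (0 : ℝ) ≤ c := by positivity
      rw [← add_assoc]
      push_cast
      nlinarith
  have hlow : Tendsto (fun r : ℕ => 1 - 48 * c * ((1 : ℝ) / ((r + c : ℕ) + 1))) atTop (𝓝 1) := by
    have h1 := ((tendsto_add_atTop_iff_nat c).2
      (tendsto_one_div_add_atTop_nhds_zero_nat (𝕜 := ℝ))).const_mul (48 * (c : ℝ))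
    simpa using h1.const_sub 1
  refine tendsto_of_tendsto_of_tendsto_of_le_of_le hlow tendsto_const_nhds (fun r => ?_)
    (fun r => ?_)
  · have hb : (0 : ℝ) < (ball G v (r + c)).ncard := by exact_mod_cast h.ncard_ball_pos v _
    have hq : ((r + c : ℕ) + 1 : ℝ) ^ 2 ≤ 4 * (ball G v (r + c)).ncard := by
      exact_mod_cast h.le_ncard_ball v (r + c)
    have hn : (0 : ℝ) < (r + c : ℕ) + 1 := by positivity
    have h2 : (c : ℝ) * (12 * (r + c + 1)) ≤
        48 * c * ((1 : ℝ) / ((r + c : ℕ) + 1)) * (ball G v (r + c)).ncard := by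
      rw [mul_one_div, div_mul_eq_mul_div, le_div_iff₀ hn]
      have hc : (0 : ℝ) ≤ c := by positivity
      push_cast at hq ⊢
      nlinarith
    show 1 - 48 * (c : ℝ) * (1 / ((r + c : ℕ) + 1)) ≤ _
    rw [le_div_iff₀ hb]
    have := hgrow r
    linarith
  · have hb : (0 : ℝ) < (ball G v (r + c)).ncard := by exact_mod_cast h.ncard_ball_pos v _
    rw [div_le_one hb]
    exact_mod_cast Set.ncard_le_ncard (h.ball_subset_ball v (Nat.le_add_right r c))
      (h.ball_finite v _)

/-- The weight `f i u` is sent from `u` to `u + t i`. If every vertex sends at least `a`, and every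
vertex receives at most `b` if it belongs to `S` and nothing otherwise, then the larger ball
contains at least `a / b` times as many elements of `S` as the ball of radius `r` has vertices.
Enlarging the radius by `c ≥ ν (t i)` ensures that no weight sent from the smaller ball is lost. -/
theorem discharging (h : GridNorm G ν) {ι : Type*} [Fintype ι] (S : Set (ℤ × ℤ)) (t : ι → ℤ × ℤ)
    (c : ℕ) (ht : ∀ i, ν (t i) ≤ c) (f : ι → ℤ × ℤ → ℕ) (a b : ℕ)
    (hlow : ∀ u, a ≤ ∑ i, f i u) (hup : ∀ w, ∑ i, f i (w - t i) ≤ b * S.indicator 1 w)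
    (v : ℤ × ℤ) (r : ℕ) :
    a * (ball G v r).ncard ≤ b * (S ∩ ball G v (r + c)).ncard := by
  obtain ⟨B, hB, -⟩ := h.exists_ball_finset v
  have hball : ∀ r, ball G v r = ↑(B r) := fun r => Set.ext fun u => by
    rw [h.mem_ball, Finset.mem_coe, hB]
  have hcount : (S ∩ ball G v (r + c)).ncard = ∑ w ∈ B (r + c), S.indicator 1 w := by
    classical
    have : S ∩ ball G v (r + c) = ↑((B (r + c)).filter (· ∈ S)) := by
      rw [hball]; ext; simp [and_comm]
    rw [this, Set.ncard_coe_finset, Finset.card_filter]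
    exact Finset.sum_congr rfl fun w _ => by simp [Set.indicator_apply]
  have hshift : ∀ i, ∑ u ∈ B r, f i u ≤ ∑ w ∈ B (r + c), f i (w - t i) := by
    intro i
    have h1 : ∑ u ∈ B r, f i u = ∑ w ∈ (B r).image (· + t i), f i (w - t i) := by
      rw [Finset.sum_image fun x _ y _ hxy => add_right_cancel hxy]
      simp
    rw [h1]
    refine Finset.sum_le_sum_of_subset fun w hw => ?_
    obtain ⟨u, hu, rfl⟩ := Finset.mem_image.1 hw
    rw [hB] at hu ⊢
    have h2 := h.add_le (u - v) (t i)
    have h3 := ht i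
    rw [show u + t i - v = u - v + t i by abel]
    omega
  calc a * (ball G v r).ncard = ∑ _u ∈ B r, a := by
        rw [hball, Set.ncard_coe_finset, Finset.sum_const, smul_eq_mul, mul_comm]
    _ ≤ ∑ u ∈ B r, ∑ i, f i u := Finset.sum_le_sum fun u _ => hlow u
    _ = ∑ i, ∑ u ∈ B r, f i u := Finset.sum_comm
    _ ≤ ∑ i, ∑ w ∈ B (r + c), f i (w - t i) := Finset.sum_le_sum fun i _ => hshift i
    _ = ∑ w ∈ B (r + c), ∑ i, f i (w - t i) := Finset.sum_comm
    _ ≤ ∑ w ∈ B (r + c), b * S.indicator 1 w := Finset.sum_le_sum fun w _ => hup w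
    _ = b * (S ∩ ball G v (r + c)).ncard := by rw [hcount, Finset.mul_sum]

theorem density_ratio_le_one (h : GridNorm G ν) (S : Set (ℤ × ℤ)) (v : ℤ × ℤ) (r : ℕ) :
    ((S ∩ ball G v r).ncard : ℝ) / (ball G v r).ncard ≤ 1 := by
  have hb : (0 : ℝ) < (ball G v r).ncard := by exact_mod_cast h.ncard_ball_pos v _
  rw [div_le_one hb]
  exact_mod_cast Set.ncard_le_ncard Set.inter_subset_right (h.ball_finite v r)

theorem le_density_of_count (h : GridNorm G ν) (S : Set (ℤ × ℤ)) (v : ℤ × ℤ) {a b : ℕ}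
    (hb : 0 < b) (c : ℕ)
    (hS : ∀ r, a * (ball G v r).ncard ≤ b * (S ∩ ball G v (r + c)).ncard) :
    (a / b : ℝ) ≤ density G v S := by
  have h1 : Tendsto (fun r : ℕ => (a / b : ℝ) *
      (((ball G v r).ncard : ℝ) / (ball G v (r + c)).ncard)) atTop (𝓝 (a / b)) := by
    simpa using (h.tendsto_ncard_ball_ratio v c).const_mul (a / b : ℝ)
  rw [density, ← Filter.limsup_nat_add _ c, ← h1.limsup_eq]
  refine Filter.limsup_le_limsup (Eventually.of_forall fun r => ?_)
    h1.isCoboundedUnder_le ?_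
  · have hp : (0 : ℝ) < (ball G v (r + c)).ncard := by exact_mod_cast h.ncard_ball_pos v _
    have hb' : (0 : ℝ) < b := by exact_mod_cast hb
    have h2 : (a : ℝ) * (ball G v r).ncard ≤ b * (S ∩ ball G v (r + c)).ncard := by
      exact_mod_cast hS r
    show (a / b : ℝ) * (((ball G v r).ncard : ℝ) / (ball G v (r + c)).ncard) ≤ _
    rw [div_mul_div_comm, div_le_div_iff₀ (by positivity) hp]
    nlinarith
  · exact isBoundedUnder_of ⟨1, fun r => h.density_ratio_le_one S v (r + c)⟩

/-- Lower bounds for both `S` and its complement determine the density of `S`; the limit superior is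
then a limit. -/
theorem density_eq_of_count (h : GridNorm G ν) (S : Set (ℤ × ℤ)) (v : ℤ × ℤ) {a b : ℕ}
    (hb : 0 < b) (hab : a ≤ b) (c : ℕ)
    (hS : ∀ r, a * (ball G v r).ncard ≤ b * (S ∩ ball G v (r + c)).ncard)
    (hSc : ∀ r, (b - a) * (ball G v r).ncard ≤ b * (Sᶜ ∩ ball G v (r + c)).ncard) :
    density G v S = (a / b : ℝ) := by
  have hb' : (0 : ℝ) < b := by exact_mod_cast hb
  have h1 : Tendsto (fun r : ℕ => (a / b : ℝ) *
      (((ball G v r).ncard : ℝ) / (ball G v (r + c)).ncard)) atTop (𝓝 (a / b)) := by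
    simpa using (h.tendsto_ncard_ball_ratio v c).const_mul (a / b : ℝ)
  have h2 : Tendsto (fun r : ℕ => 1 - (1 - a / b : ℝ) *
      (((ball G v r).ncard : ℝ) / (ball G v (r + c)).ncard)) atTop (𝓝 (a / b)) := by
    simpa using ((h.tendsto_ncard_ball_ratio v c).const_mul (1 - a / b : ℝ)).const_sub 1
  have h3 : Tendsto (fun r : ℕ => ((S ∩ ball G v (r + c)).ncard : ℝ) /
      (ball G v (r + c)).ncard) atTop (𝓝 (a / b)) := by
    refine tendsto_of_tendsto_of_tendsto_of_le_of_le h1 h2 (fun r => ?_) (fun r => ?_)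
    · have hp : (0 : ℝ) < (ball G v (r + c)).ncard := by exact_mod_cast h.ncard_ball_pos v _
      have h4 : (a : ℝ) * (ball G v r).ncard ≤ b * (S ∩ ball G v (r + c)).ncard := by
        exact_mod_cast hS r
      show (a / b : ℝ) * (((ball G v r).ncard : ℝ) / (ball G v (r + c)).ncard) ≤ _
      rw [div_mul_div_comm, div_le_div_iff₀ (by positivity) hp]
      nlinarith
    · have hp : (0 : ℝ) < (ball G v (r + c)).ncard := by exact_mod_cast h.ncard_ball_pos v _
      have h4 : ((b : ℝ) - a) * (ball G v r).ncard ≤ b * (Sᶜ ∩ ball G v (r + c)).ncard := by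
        rw [← Nat.cast_sub hab]
        exact_mod_cast hSc r
      have h5 : ((S ∩ ball G v (r + c)).ncard : ℝ) + (Sᶜ ∩ ball G v (r + c)).ncard =
          (ball G v (r + c)).ncard := by
        have := Set.ncard_inter_add_ncard_sdiff_eq_ncard (ball G v (r + c)) S (h.ball_finite v _)
        rw [Set.inter_comm, Set.sdiff_eq, Set.inter_comm _ Sᶜ] at this
        exact_mod_cast this
      have h6 : (1 - a / b : ℝ) = (b - a) / b := by field_simp
      show _ ≤ 1 - (1 - a / b : ℝ) * (((ball G v r).ncard : ℝ) / (ball G v (r + c)).ncard)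
      rw [le_sub_iff_add_le, h6, div_mul_div_comm, div_add_div _ _ hp.ne' (by positivity),
        div_le_one (by positivity)]
      have h7 := mul_le_mul_of_nonneg_left h4 hp.le
      have h8 := congrArg (· * ((b : ℝ) * (ball G v (r + c)).ncard)) h5
      linarith
  rw [density, ← Filter.limsup_nat_add _ c]
  exact h3.limsup_eq

end GridNorm

/-! ### Error-correcting sets through finite sums; periodic sets -/

theorem encard_inter_eq_sum {V : Type*} (F : Finset V) (S : Set V) :
    ((F : Set V) ∩ S).encard = ((∑ p ∈ F, S.indicator 1 p : ℕ) : ℕ∞) := by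
  classical
  have h1 : (F : Set V) ∩ S = ↑(F.filter (· ∈ S)) := by ext; simp
  rw [h1, Set.encard_coe_eq_coe_finsetCard, Finset.card_filter]
  simp [Set.indicator_apply]

namespace GridNorm

variable {G : SimpleGraph (ℤ × ℤ)} {ν : ℤ × ℤ → ℕ}

theorem neighborSet_eq (h : GridNorm G ν) {N : Finset (ℤ × ℤ)} (hN : ∀ p, p ∈ N ↔ ν p = 1)
    (v : ℤ × ℤ) : G.neighborSet v = ↑(N.image (v + ·)) := by
  ext u
  rw [SimpleGraph.mem_neighborSet, h.adj_iff, ← hN, Finset.mem_coe, Finset.mem_image]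
  constructor
  · exact fun hu => ⟨_, hu, add_sub_cancel v u⟩
  · rintro ⟨t, ht, rfl⟩
    rwa [add_sub_cancel_left]

/-- Error-correcting open-locating-dominating sets in terms of the set `N` of neighbours of the
origin. The second vertex of a pair is written `v + d`, so that both conditions are about translates
of fixed finite sets. -/
theorem isErrOld_iff_sum (h : GridNorm G ν) {N : Finset (ℤ × ℤ)} (hN : ∀ p, p ∈ N ↔ ν p = 1)
    (S : Set (ℤ × ℤ)) :
    IsErrOld G S ↔ (∀ v, 3 ≤ ∑ t ∈ N, S.indicator (1 : ℤ × ℤ → ℕ) (v + t)) ∧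
      ∀ v d, d ≠ 0 →
        3 ≤ ∑ t ∈ symmDiff N (N.image (d + ·)), S.indicator (1 : ℤ × ℤ → ℕ) (v + t) := by
  have key : ∀ (F : Finset (ℤ × ℤ)) (v : ℤ × ℤ),
      3 ≤ (((F.image (v + ·) : Finset (ℤ × ℤ)) : Set (ℤ × ℤ)) ∩ S).encard ↔
        3 ≤ ∑ t ∈ F, S.indicator (1 : ℤ × ℤ → ℕ) (v + t) := by
    intro F v
    rw [encard_inter_eq_sum, Finset.sum_image fun x _ y _ hxy => add_left_cancel hxy]
    exact Nat.cast_le (α := ℕ∞) (m := 3)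
  have hdiff : ∀ v d, symmDiff (G.neighborSet v ∩ S) (G.neighborSet (v + d) ∩ S) =
      (((symmDiff N (N.image (d + ·))).image (v + ·) : Finset (ℤ × ℤ)) : Set (ℤ × ℤ)) ∩ S := by
    intro v d
    rw [Finset.image_symmDiff _ _ (add_right_injective v), Finset.image_image,
      Finset.coe_symmDiff, h.neighborSet_eq hN, h.neighborSet_eq hN]
    have : ((v + ·) ∘ (d + ·) : ℤ × ℤ → ℤ × ℤ) = (v + d + ·) := by
      funext x; simp [add_assoc]
    rw [this]
    exact (inf_symmDiff_distrib_right _ _ _).symm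
  rw [isErrOld_iff]
  refine and_congr (forall_congr' fun v => ?_) (forall_congr' fun v => ?_)
  · rw [h.neighborSet_eq hN, key]
  · constructor
    · intro hu d hd
      rw [← key, ← hdiff]
      exact hu _ (by simpa using hd)
    · intro hu w hvw
      rw [← add_sub_cancel v w, hdiff, key]
      exact hu _ (sub_ne_zero.2 hvw.symm)

variable {n : ℕ} (P : ZMod n → ZMod n → Bool)

theorem indicator_periodic (p : ℤ × ℤ) :
    Set.indicator {p : ℤ × ℤ | P p.1 p.2} (1 : ℤ × ℤ → ℕ) p = (P p.1 p.2).toNat := by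
  cases hp : P p.1 p.2 <;> simp [hp]

/-- A criterion for a set given by residues modulo `n` that involves finitely many conditions. If
`N` and `d + N` are disjoint, their symmetric difference contains `N` and needs no attention, so
only the `d` in the difference set of `N` matter, and of `d` and `-d` only one. -/
theorem isErrOld_of_periodic (h : GridNorm G ν) {N : Finset (ℤ × ℤ)} (hN : ∀ p, p ∈ N ↔ ν p = 1)
    (D : Finset (ℤ × ℤ)) (hD : ∀ x ∈ N, ∀ y ∈ N, x ≠ y → x - y ∈ D ∨ y - x ∈ D)
    (h1 : ∀ a b, 3 ≤ ∑ t ∈ N, (P (a + t.1) (b + t.2)).toNat)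
    (h2 : ∀ d ∈ D, ∀ a b,
      3 ≤ ∑ t ∈ symmDiff N (N.image (d + ·)), (P (a + t.1) (b + t.2)).toNat) :
    IsErrOld G {p : ℤ × ℤ | P p.1 p.2} := by
  have hind : ∀ v t : ℤ × ℤ, Set.indicator {p : ℤ × ℤ | P p.1 p.2} (1 : ℤ × ℤ → ℕ) (v + t) =
      (P (v.1 + t.1) (v.2 + t.2)).toNat := by
    intro v t
    rw [indicator_periodic, Prod.fst_add, Prod.snd_add, Int.cast_add, Int.cast_add]
  have h1' : ∀ v : ℤ × ℤ, 3 ≤ ∑ t ∈ N,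
      Set.indicator {p : ℤ × ℤ | P p.1 p.2} (1 : ℤ × ℤ → ℕ) (v + t) := by
    intro v
    simp only [hind]
    exact h1 _ _
  have h2' : ∀ d ∈ D, ∀ v : ℤ × ℤ, 3 ≤ ∑ t ∈ symmDiff N (N.image (d + ·)),
      Set.indicator {p : ℤ × ℤ | P p.1 p.2} (1 : ℤ × ℤ → ℕ) (v + t) := by
    intro d hd v
    simp only [hind]
    exact h2 d hd _ _
  refine (h.isErrOld_iff_sum hN _).2 ⟨h1', fun v d hd => ?_⟩
  by_cases hdis : Disjoint N (N.image (d + ·))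
  · rw [hdis.symmDiff_eq_sup]
    exact (h1' v).trans (Finset.sum_le_sum_of_subset Finset.subset_union_left)
  obtain ⟨x, hx, hx'⟩ := Finset.not_disjoint_iff.1 hdis
  obtain ⟨y, hy, rfl⟩ := Finset.mem_image.1 hx'
  rcases hD _ hx _ hy (by simpa using hd) with h3 | h3
  · rw [add_sub_cancel_right] at h3
    exact h2' d h3 v
  · -- the pair `(v, v + d)` is the pair `(w, w - d)` for `w = v + d`
    rw [sub_add_cancel_right] at h3
    have h4 : symmDiff N (N.image (d + ·)) =
        (symmDiff N (N.image (-d + ·))).image (d + ·) := by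
      rw [Finset.image_symmDiff _ _ (add_right_injective d), Finset.image_image, symmDiff_comm]
      congr 1
      simp [Function.comp_def]
    rw [h4, Finset.sum_image fun x _ y _ hxy => add_left_cancel hxy]
    simpa only [add_assoc] using h2' (-d) h3 (v + d)

/-- A set given by residues modulo `n` has the density of its period. The discharging sends weight 1
from every vertex to every cell of the set in its translate of `[0, n) × [0, n)`. -/
theorem density_of_periodic [NeZero n] (h : GridNorm G ν) {m : ℕ} (hm : ∑ a, ∑ b, (P a b).toNat = m)
    (v : ℤ × ℤ) : density G v {p : ℤ × ℤ | P p.1 p.2} = (m / (n ^ 2 : ℕ) : ℝ) := by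
  let t : ZMod n × ZMod n → ℤ × ℤ := fun q => ((q.1.val : ℤ), (q.2.val : ℤ))
  have ht : ∀ q, ν (t q) ≤ 2 * n := by
    intro q
    have h1 := h.quadrant q.1.val q.2.val
    have h2 := ZMod.val_lt q.1
    have h3 := ZMod.val_lt q.2
    show ν ((q.1.val : ℤ), (q.2.val : ℤ)) ≤ 2 * n
    omega
  have hsum : ∀ (Q : ZMod n → ZMod n → Bool) (u : ℤ × ℤ),
      ∑ q, Set.indicator {p : ℤ × ℤ | Q p.1 p.2} (1 : ℤ × ℤ → ℕ) (u + t q) =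
        ∑ a, ∑ b, (Q a b).toNat := by
    intro Q u
    rw [← Fintype.sum_prod_type' (f := fun a b => (Q a b).toNat),
      ← Equiv.sum_comp (Equiv.addLeft ((u.1 : ZMod n), (u.2 : ZMod n)))
        fun q => (Q q.1 q.2).toNat]
    refine Finset.sum_congr rfl fun q _ => ?_
    have h1 : (((u + t q).1 : ℤ) : ZMod n) = u.1 + q.1 := by simp [t]
    have h2 : (((u + t q).2 : ℤ) : ZMod n) = u.2 + q.2 := by simp [t]
    rw [indicator_periodic, h1, h2, Equiv.coe_addLeft, Prod.fst_add, Prod.snd_add]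
  have hcard : Fintype.card (ZMod n × ZMod n) = n ^ 2 := by
    rw [Fintype.card_prod, ZMod.card, sq]
  have htot : (∑ a, ∑ b, (P a b).toNat) + ∑ a, ∑ b, (!P a b).toNat = n ^ 2 := by
    rw [← hcard, ← Finset.sum_add_distrib, Fintype.card_prod]
    have : ∀ a, (∑ b, (P a b).toNat) + ∑ b, (!P a b).toNat = Fintype.card (ZMod n) := by
      intro a
      rw [← Finset.sum_add_distrib, ← Finset.card_univ, Finset.card_eq_sum_ones]
      exact Finset.sum_congr rfl fun b _ => by cases P a b <;> rfl
    rw [Finset.sum_congr rfl fun a _ => this a, Finset.sum_const, Finset.card_univ, smul_eq_mul]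
  have hcompl : {p : ℤ × ℤ | P p.1 p.2}ᶜ = {p : ℤ × ℤ | (!P p.1 p.2) = true} := by
    ext p; simp
  have hcount : ∀ (Q : ZMod n → ZMod n → Bool) (r : ℕ),
      (∑ a, ∑ b, (Q a b).toNat) * (ball G v r).ncard ≤
        n ^ 2 * ({p : ℤ × ℤ | Q p.1 p.2} ∩ ball G v (r + 2 * n)).ncard := by
    intro Q r
    refine h.discharging _ t (2 * n) ht
      (fun q u => Set.indicator {p : ℤ × ℤ | Q p.1 p.2} 1 (u + t q)) _ _
      (fun u => (hsum Q u).ge) (fun w => ?_) v r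
    simp only [sub_add_cancel, Finset.sum_const, Finset.card_univ, hcard, smul_eq_mul, le_refl]
  refine h.density_eq_of_count _ v (pow_pos (NeZero.pos n) 2) (by omega) (2 * n) (fun r => ?_)
    (fun r => ?_)
  · rw [← hm]; exact hcount P r
  · rw [hcompl, ← hm, ← htot, Nat.add_sub_cancel_left, htot]
    exact hcount (fun a b => !P a b) r

theorem errOldPercent_bounds (h : GridNorm G ν) {v : ℤ × ℤ} {a b : ℕ} (hb : 0 < b) (c : ℕ)
    (hlow : ∀ S, IsErrOld G S → ∀ r, a * (ball G v r).ncard ≤ b * (S ∩ ball G v (r + c)).ncard)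
    {S₀ : Set (ℤ × ℤ)} (hS₀ : IsErrOld G S₀) :
    (a / b : ℝ) ≤ errOldPercent G v ∧ errOldPercent G v ≤ density G v S₀ := by
  have h1 : ∀ d ∈ {d : ℝ | ∃ S : Set (ℤ × ℤ), IsErrOld G S ∧ density G v S = d},
      (a / b : ℝ) ≤ d := by
    rintro d ⟨S, hS, rfl⟩
    exact h.le_density_of_count S v hb c (hlow S hS)
  exact ⟨le_csInf ⟨_, S₀, hS₀, rfl⟩ h1, csInf_le ⟨_, h1⟩ ⟨S₀, hS₀, rfl⟩⟩

end GridNorm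

/-! ### The three grids and periodic sets in them -/

/-- The `ℓ¹` norm, which gives the distance in the square grid. -/
def sqrNorm (p : ℤ × ℤ) : ℕ := p.1.natAbs + p.2.natAbs

/-- The hexagonal norm, which gives the distance in the triangular grid. Its unit vectors are the
six neighbours of the origin. -/
def triNorm (p : ℤ × ℤ) : ℕ := max (max p.1.natAbs p.2.natAbs) (p.1 + p.2).natAbs

/-- The `ℓ∞` norm, which gives the distance in the king grid. -/
def kngNorm (p : ℤ × ℤ) : ℕ := max p.1.natAbs p.2.natAbs

theorem gridNorm_sqr : GridNorm SQR sqrNorm where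
  zero := rfl
  eq_zero := by
    rintro ⟨x, y⟩ h
    simp only [sqrNorm, Prod.mk_eq_zero] at *
    omega
  add_le := by
    rintro ⟨x, y⟩ ⟨z, w⟩
    simp only [sqrNorm, Prod.mk_add_mk]
    omega
  adj_iff := by
    rintro ⟨x, y⟩ ⟨z, w⟩
    simp only [SQR, sqrNorm, Prod.mk_sub_mk, Int.abs_eq_natAbs]
    omega
  step := by
    rintro ⟨x, y⟩ n h
    simp only [sqrNorm] at h
    by_cases hx : x = 0
    · refine ⟨(0, y.sign), ?_, ?_⟩ <;> simp only [sqrNorm, Prod.mk_sub_mk] <;>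
      rcases lt_trichotomy y 0 with h1 | h1 | h1 <;>
      simp only [Int.sign_eq_neg_one_of_neg, Int.sign_eq_one_of_pos, h1, Int.sign_zero] <;> omega
    · refine ⟨(x.sign, 0), ?_, ?_⟩ <;> simp only [sqrNorm, Prod.mk_sub_mk] <;>
      rcases lt_or_gt_of_ne hx with h1 | h1 <;>
      simp only [Int.sign_eq_neg_one_of_neg, Int.sign_eq_one_of_pos, h1] <;> omega
  quadrant := by
    intro i j
    simp only [sqrNorm]
    omega
  sphere := by
    refine ⟨fun k n t => if k = 0 then (t, n - t) else if k = 1 then (t, -n - t) else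
      if k = 2 then (t, n + t) else (t, t - n), ?_⟩
    rintro ⟨x, y⟩
    have hx : x ∈ Finset.Icc (-(sqrNorm (x, y) : ℤ)) (sqrNorm (x, y)) := by
      simp only [Finset.mem_Icc, sqrNorm]; omega
    rcases le_total 0 x with h1 | h1 <;> rcases le_total 0 y with h2 | h2
    · exact ⟨0, x, hx, by simp [sqrNorm, abs_of_nonneg, *]⟩
    · exact ⟨3, x, hx, by simp [sqrNorm, abs_of_nonneg, abs_of_nonpos, *]⟩
    · exact ⟨2, x, hx, by simp [sqrNorm, abs_of_nonneg, abs_of_nonpos, *]⟩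
    · exact ⟨1, x, hx, by simp [sqrNorm, abs_of_nonpos, *]⟩

theorem gridNorm_kng : GridNorm KNG kngNorm where
  zero := rfl
  eq_zero := by
    rintro ⟨x, y⟩ h
    simp only [kngNorm, Prod.mk_eq_zero] at *
    omega
  add_le := by
    rintro ⟨x, y⟩ ⟨z, w⟩
    simp only [kngNorm, Prod.mk_add_mk]
    omega
  adj_iff := by
    rintro ⟨x, y⟩ ⟨z, w⟩
    simp only [KNG, kngNorm, Prod.mk_sub_mk, ne_eq, Prod.mk.injEq, abs_le]
    omega
  step := by
    rintro ⟨x, y⟩ n h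
    simp only [kngNorm] at h
    refine ⟨(x.sign, y.sign), ?_, ?_⟩ <;> simp only [kngNorm, Prod.mk_sub_mk] <;>
      rcases lt_trichotomy x 0 with h1 | h1 | h1 <;>
      rcases lt_trichotomy y 0 with h2 | h2 | h2 <;>
      simp only [Int.sign_eq_neg_one_of_neg, Int.sign_eq_one_of_pos, h1, h2, Int.sign_zero] <;>
      omega
  quadrant := by
    intro i j
    simp only [kngNorm]
    omega
  sphere := by
    refine ⟨fun k n t => if k = 0 then (n, t) else if k = 1 then (-n, t) else
      if k = 2 then (t, n) else (t, -n), ?_⟩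
    rintro ⟨x, y⟩
    have hx : x ∈ Finset.Icc (-(kngNorm (x, y) : ℤ)) (kngNorm (x, y)) := by
      simp only [Finset.mem_Icc, kngNorm]; omega
    have hy : y ∈ Finset.Icc (-(kngNorm (x, y) : ℤ)) (kngNorm (x, y)) := by
      simp only [Finset.mem_Icc, kngNorm]; omega
    have h : x = kngNorm (x, y) ∨ x = -kngNorm (x, y) ∨ y = kngNorm (x, y) ∨
        y = -kngNorm (x, y) := by
      simp only [kngNorm]; omega
    rcases h with h | h | h | h
    · exact ⟨0, y, hy, Prod.ext (by simpa using h.symm) rfl⟩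
    · exact ⟨1, y, hy, Prod.ext (by simpa using h.symm) rfl⟩
    · exact ⟨2, x, hx, Prod.ext rfl (by simpa using h.symm)⟩
    · exact ⟨3, x, hx, Prod.ext rfl (by simpa using h.symm)⟩

theorem triNorm_le_iff {x y : ℤ} {n : ℕ} : triNorm (x, y) ≤ n ↔
    (-n ≤ x ∧ x ≤ n) ∧ (-n ≤ y ∧ y ≤ n) ∧ -n ≤ x + y ∧ x + y ≤ n := by
  simp only [triNorm, max_le_iff]
  omega

theorem triNorm_eq_succ_iff {x y : ℤ} {n : ℕ} : triNorm (x, y) = n + 1 ↔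
    ((-(n + 1) ≤ x ∧ x ≤ n + 1) ∧ (-(n + 1) ≤ y ∧ y ≤ n + 1) ∧ -(n + 1) ≤ x + y ∧ x + y ≤ n + 1) ∧
    (x = n + 1 ∨ x = -(n + 1) ∨ y = n + 1 ∨ y = -(n + 1) ∨ x + y = n + 1 ∨ x + y = -(n + 1)) := by
  have h1 := triNorm_le_iff (x := x) (y := y) (n := n + 1)
  have h2 := triNorm_le_iff (x := x) (y := y) (n := n)
  have h3 : triNorm (x, y) = n + 1 ↔ triNorm (x, y) ≤ n + 1 ∧ ¬ triNorm (x, y) ≤ n := by omega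
  rw [h3, h1, h2]
  push_cast
  omega

theorem triNorm_eq_one_iff (p : ℤ × ℤ) : triNorm p = 1 ↔
    p ∈ ({(1, 0), (-1, 0), (0, 1), (0, -1), (1, -1), (-1, 1)} : Finset (ℤ × ℤ)) := by
  obtain ⟨x, y⟩ := p
  rw [← zero_add 1, triNorm_eq_succ_iff]
  simp only [Finset.mem_insert, Finset.mem_singleton, Prod.mk.injEq]
  omega

theorem triNorm_add_le (p q : ℤ × ℤ) : triNorm (p + q) ≤ triNorm p + triNorm q := by
  obtain ⟨x, y⟩ := p
  obtain ⟨z, w⟩ := q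
  have h1 := triNorm_le_iff.1 (le_refl (triNorm (x, y)))
  have h2 := triNorm_le_iff.1 (le_refl (triNorm (z, w)))
  rw [Prod.mk_add_mk, triNorm_le_iff]
  push_cast
  omega

theorem exists_triNorm_sub_eq (p : ℤ × ℤ) (n : ℕ) (h : triNorm p = n + 1) :
    ∃ q, triNorm q = 1 ∧ triNorm (p - q) = n := by
  obtain ⟨x, y⟩ := p
  suffices h1 : ∃ q, triNorm q = 1 ∧ triNorm ((x, y) - q) ≤ n by
    obtain ⟨q, hq, hn⟩ := h1
    have h2 := triNorm_add_le ((x, y) - q) q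
    rw [sub_add_cancel] at h2
    exact ⟨q, hq, by omega⟩
  rw [triNorm_eq_succ_iff] at h
  have key : ∀ a b : ℤ, triNorm (a, b) = 1 → triNorm (x - a, y - b) ≤ n →
      ∃ q, triNorm q = 1 ∧ triNorm ((x, y) - q) ≤ n := fun a b h1 h2 => ⟨(a, b), h1, h2⟩
  obtain ⟨h, hs⟩ := h
  rcases lt_trichotomy x 0 with hx | hx | hx <;> rcases lt_trichotomy y 0 with hy | hy | hy
  · exact key (-1) 0 rfl (triNorm_le_iff.2 (by omega))
  · exact key (-1) 0 rfl (triNorm_le_iff.2 (by omega))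
  · exact key (-1) 1 rfl (triNorm_le_iff.2 (by omega))
  · exact key 0 (-1) rfl (triNorm_le_iff.2 (by omega))
  · omega
  · exact key 0 1 rfl (triNorm_le_iff.2 (by omega))
  · exact key 1 (-1) rfl (triNorm_le_iff.2 (by omega))
  · exact key 1 0 rfl (triNorm_le_iff.2 (by omega))
  · exact key 1 0 rfl (triNorm_le_iff.2 (by omega))

theorem gridNorm_tri : GridNorm TRI triNorm where
  zero := rfl
  eq_zero := by
    rintro ⟨x, y⟩ h
    have h1 := triNorm_le_iff.1 h.le
    rw [Prod.mk_eq_zero]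
    omega
  add_le := triNorm_add_le
  adj_iff := by
    rintro ⟨x, y⟩ ⟨z, w⟩
    rw [triNorm_eq_one_iff]
    simp only [TRI, Prod.mk_sub_mk, Finset.mem_insert, Finset.mem_singleton, Prod.mk.injEq,
      Int.abs_eq_natAbs]
    omega
  step := exists_triNorm_sub_eq
  quadrant := by
    intro i j
    rw [triNorm_le_iff]
    push_cast
    omega
  sphere := by
    refine ⟨fun k n t => if k = 0 then (n, t) else if k = 1 then (-n, t) else
      if k = 2 then (t, n) else if k = 3 then (t, -n) else
      if k = 4 then (t, n - t) else (t, -n - t), ?_⟩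
    rintro ⟨x, y⟩
    have hle := triNorm_le_iff.1 (le_refl (triNorm (x, y)))
    have hx : x ∈ Finset.Icc (-(triNorm (x, y) : ℤ)) (triNorm (x, y)) := Finset.mem_Icc.2 hle.1
    have hy : y ∈ Finset.Icc (-(triNorm (x, y) : ℤ)) (triNorm (x, y)) := Finset.mem_Icc.2 hle.2.1
    have h : x = triNorm (x, y) ∨ x = -triNorm (x, y) ∨ y = triNorm (x, y) ∨
        y = -triNorm (x, y) ∨ y = triNorm (x, y) - x ∨ y = -triNorm (x, y) - x := by
      rcases Nat.eq_zero_or_eq_succ_pred (triNorm (x, y)) with h0 | h0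
      · omega
      · have h1 := (triNorm_eq_succ_iff.1 h0).2
        omega
    rcases h with h | h | h | h | h | h
    · exact ⟨0, y, hy, Prod.ext (by simpa using h.symm) rfl⟩
    · exact ⟨1, y, hy, Prod.ext (by simpa using h.symm) rfl⟩
    · exact ⟨2, x, hx, Prod.ext rfl (by simpa using h.symm)⟩
    · exact ⟨3, x, hx, Prod.ext rfl (by simpa using h.symm)⟩
    · exact ⟨4, x, hx, Prod.ext rfl (by simpa using h.symm)⟩
    · exact ⟨5, x, hx, Prod.ext rfl (by simpa using h.symm)⟩

/-- The neighbours of the origin in the square grid. -/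
def sqrNbr : Finset (ℤ × ℤ) := {(1, 0), (-1, 0), (0, 1), (0, -1)}

/-- The neighbours of the origin in the triangular grid. -/
def triNbr : Finset (ℤ × ℤ) := {(1, 0), (-1, 0), (0, 1), (0, -1), (1, -1), (-1, 1)}

/-- The neighbours of the origin in the king grid. -/
def kngNbr : Finset (ℤ × ℤ) :=
  {(1, 0), (1, 1), (0, 1), (-1, 1), (-1, 0), (-1, -1), (0, -1), (1, -1)}

theorem mem_sqrNbr (p : ℤ × ℤ) : p ∈ sqrNbr ↔ sqrNorm p = 1 := by
  obtain ⟨x, y⟩ := p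
  simp only [sqrNbr, sqrNorm, Finset.mem_insert, Finset.mem_singleton, Prod.mk.injEq]
  omega

theorem mem_triNbr (p : ℤ × ℤ) : p ∈ triNbr ↔ triNorm p = 1 := (triNorm_eq_one_iff p).symm

theorem mem_kngNbr (p : ℤ × ℤ) : p ∈ kngNbr ↔ kngNorm p = 1 := by
  obtain ⟨x, y⟩ := p
  simp only [kngNbr, kngNorm, Finset.mem_insert, Finset.mem_singleton, Prod.mk.injEq]
  omega

/-- All residues modulo 8 except the line `a + 2 b = 0`: seven cells out of eight. -/
def sqrPattern (a b : ZMod 8) : Bool := a + 2 * b ≠ 0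

/-- Four of the seven lines `a + 3 b = c` modulo 7: four cells out of seven. -/
def triPattern (a b : ZMod 7) : Bool := a + 3 * b ∈ ({2, 4, 5, 6} : Finset (ZMod 7))

/-- Half of the cells modulo 6, those with `a + b` even, without two of these 18 cells: sixteen
cells out of 36. -/
def kngPattern (a b : ZMod 6) : Bool :=
  (a + b) ∈ ({0, 2, 4} : Finset (ZMod 6)) ∧
    (a, b) ∉ ({(4, 2), (1, 5)} : Finset (ZMod 6 × ZMod 6))

theorem isErrOld_sqrPattern : IsErrOld SQR {p : ℤ × ℤ | sqrPattern p.1 p.2} :=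
  gridNorm_sqr.isErrOld_of_periodic _ mem_sqrNbr
    {(2, 0), (0, 2), (1, 1), (1, -1)}
    (by decide +kernel) (by decide +kernel) (by decide +kernel)

theorem isErrOld_triPattern : IsErrOld TRI {p : ℤ × ℤ | triPattern p.1 p.2} :=
  gridNorm_tri.isErrOld_of_periodic _ mem_triNbr
    {(1, 0), (0, 1), (1, -1), (2, 0), (0, 2), (2, -2), (1, 1), (2, -1), (1, -2)}
    (by decide +kernel) (by decide +kernel) (by decide +kernel)

theorem isErrOld_kngPattern : IsErrOld KNG {p : ℤ × ℤ | kngPattern p.1 p.2} :=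
  gridNorm_kng.isErrOld_of_periodic _ mem_kngNbr
    {(1, 0), (2, 0), (0, 1), (0, 2), (1, 1), (1, 2), (2, 1), (2, 2), (1, -1), (1, -2), (2, -1),
      (2, -2)}
    (by decide +kernel) (by decide +kernel) (by decide +kernel)

theorem density_sqrPattern (v : ℤ × ℤ) :
    density SQR v {p : ℤ × ℤ | sqrPattern p.1 p.2} = 7 / 8 := by
  rw [gridNorm_sqr.density_of_periodic sqrPattern (m := 56) (by decide +kernel)]
  norm_num

theorem density_triPattern (v : ℤ × ℤ) :
    density TRI v {p : ℤ × ℤ | triPattern p.1 p.2} = 4 / 7 := by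
  rw [gridNorm_tri.density_of_periodic triPattern (m := 28) (by decide +kernel)]
  norm_num

theorem density_kngPattern (v : ℤ × ℤ) :
    density KNG v {p : ℤ × ℤ | kngPattern p.1 p.2} = 4 / 9 := by
  rw [gridNorm_kng.density_of_periodic kngPattern (m := 16) (by decide +kernel)]
  norm_num

/-! ### Lower bound for the square grid -/

theorem indicator_one_le_one (S : Set (ℤ × ℤ)) (p : ℤ × ℤ) :
    S.indicator (1 : ℤ × ℤ → ℕ) p ≤ 1 :=
  Set.indicator_apply_le' (fun _ => le_rfl) fun _ => zero_le_one

theorem sum_sqrNbr (g : ℤ × ℤ → ℕ) :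
    ∑ t ∈ sqrNbr, g t = g (1, 0) + (g (-1, 0) + (g (0, 1) + g (0, -1))) := by
  simp [sqrNbr]

theorem sum_symmDiff_sqrNbr_diag (g : ℤ × ℤ → ℕ) :
    ∑ t ∈ symmDiff sqrNbr (sqrNbr.image ((1, 1) + ·)), g t =
      g (-1, 0) + (g (0, -1) + (g (2, 1) + g (1, 2))) := by
  have h : symmDiff sqrNbr (sqrNbr.image ((1, 1) + ·)) =
      {(-1, 0), (0, -1), (2, 1), (1, 2)} := by decide
  rw [h]
  simp

theorem sum_symmDiff_sqrNbr_antidiag (g : ℤ × ℤ → ℕ) :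
    ∑ t ∈ symmDiff sqrNbr (sqrNbr.image ((1, -1) + ·)), g t =
      g (-1, 0) + (g (0, 1) + (g (2, -1) + g (1, -2))) := by
  have h : symmDiff sqrNbr (sqrNbr.image ((1, -1) + ·)) =
      {(-1, 0), (0, 1), (2, -1), (1, -2)} := by decide
  rw [h]
  simp

/-- Seven cells `(x, y)` with `x + y` even, chosen such that any two of them lie in a neighbourhood
or in a symmetric difference of two neighbourhoods that has only four cells. -/
def sqrTile : Fin 7 → ℤ × ℤ :=
  ![(-1, -1), (-1, 1), (0, 0), (1, -1), (0, 2), (1, 1), (2, 0)]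

/-- A translate of `sqrTile` contains at most one cell without a detector. The four neighbourhoods
and three symmetric differences used below, each with at least three detectors among its four cells,
cover all 21 pairs of cells of the tile. -/
theorem six_le_sum_sqrTile {S : Set (ℤ × ℤ)} (hS : IsErrOld SQR S) (u : ℤ × ℤ) :
    6 ≤ ∑ i, S.indicator (1 : ℤ × ℤ → ℕ) (u + sqrTile i) := by
  obtain ⟨h1, h2⟩ := (gridNorm_sqr.isErrOld_iff_sum mem_sqrNbr S).1 hS
  let s : ℤ → ℤ → ℕ := fun x y => S.indicator (1 : ℤ × ℤ → ℕ) (u + (x, y))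
  have hs : ∀ x y z w,
      S.indicator (1 : ℤ × ℤ → ℕ) (u + (x, y) + (z, w)) = s (x + z) (y + w) := fun x y z w => by
    simp only [s, add_assoc, Prod.mk_add_mk]
  have hN : ∀ x y, 3 ≤ s (x + 1) (y + 0) + (s (x + -1) (y + 0) +
      (s (x + 0) (y + 1) + s (x + 0) (y + -1))) := fun x y => by
    simpa only [sum_sqrNbr, hs] using h1 (u + (x, y))
  have hD : ∀ x y, 3 ≤ s (x + -1) (y + 0) + (s (x + 0) (y + -1) +
      (s (x + 2) (y + 1) + s (x + 1) (y + 2))) := fun x y => by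
    simpa only [sum_symmDiff_sqrNbr_diag, hs] using h2 (u + (x, y)) (1, 1) (by decide)
  have hA : ∀ x y, 3 ≤ s (x + -1) (y + 0) + (s (x + 0) (y + 1) +
      (s (x + 2) (y + -1) + s (x + 1) (y + -2))) := fun x y => by
    simpa only [sum_symmDiff_sqrNbr_antidiag, hs] using h2 (u + (x, y)) (1, -1) (by decide)
  have a1 : 3 ≤ s 1 1 + (s (-1) 1 + (s 0 2 + s 0 0)) := by simpa using hN 0 1
  have a2 : 3 ≤ s 2 0 + (s 0 0 + (s 1 1 + s 1 (-1))) := by simpa using hN 1 0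
  have a3 : 3 ≤ s 1 (-1) + (s (-1) (-1) + (s 0 0 + s 0 (-2))) := by simpa using hN 0 (-1)
  have a4 : 3 ≤ s 0 0 + (s (-2) 0 + (s (-1) 1 + s (-1) (-1))) := by simpa using hN (-1) 0
  have a5 : 3 ≤ s (-1) (-1) + (s 0 (-2) + (s 2 0 + s 1 1)) := by simpa using hD 0 (-1)
  have a6 : 3 ≤ s (-2) 0 + (s (-1) (-1) + (s 1 1 + s 0 2)) := by simpa using hD (-1) 0
  have a7 : 3 ≤ s (-1) 1 + (s 0 2 + (s 2 0 + s 1 (-1))) := by simpa using hA 0 1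
  have hb : ∀ x y, s x y ≤ 1 := fun x y => indicator_one_le_one S (u + (x, y))
  have hsum : ∑ i, S.indicator (1 : ℤ × ℤ → ℕ) (u + sqrTile i) =
      s (-1) (-1) + s (-1) 1 + s 0 0 + s 1 (-1) + s 0 2 + s 1 1 + s 2 0 :=
    Fin.sum_univ_seven _
  have b1 := hb (-1) (-1)
  have b2 := hb (-1) (1)
  have b3 := hb (0) (0)
  have b4 := hb (1) (-1)
  have b5 := hb (0) (2)
  have b6 := hb (1) (1)
  have b7 := hb (2) (0)
  have b8 := hb (-2) (0)
  have b9 := hb (0) (-2)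
  omega

/-- Each vertex sends weight 1 to the detectors in its translate of `sqrTile`: at least 6 are sent,
and a detector receives 7. -/
theorem sqr_count {S : Set (ℤ × ℤ)} (hS : IsErrOld SQR S) (v : ℤ × ℤ) (r : ℕ) :
    6 * (ball SQR v r).ncard ≤ 7 * (S ∩ ball SQR v (r + 2)).ncard := by
  refine gridNorm_sqr.discharging S sqrTile 2 (by decide)
    (fun i u => S.indicator 1 (u + sqrTile i)) 6 7 (six_le_sum_sqrTile hS) (fun w => ?_) v r
  simp only [sub_add_cancel, Finset.sum_const, Finset.card_univ, Fintype.card_fin, smul_eq_mul,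
    le_refl]

/-! ### Lower bound for the triangular grid -/

theorem sum_symmDiff_add {α : Type*} [DecidableEq α] (A B : Finset α) (g : α → ℕ) :
    ∑ t ∈ symmDiff A B, g t + 2 * ∑ t ∈ A ∩ B, g t = ∑ t ∈ A, g t + ∑ t ∈ B, g t := by
  have h1 := Finset.sum_sdiff (f := g) (Finset.inter_subset_left : A ∩ B ⊆ A)
  have h2 := Finset.sum_sdiff (f := g) (Finset.inter_subset_right : A ∩ B ⊆ B)
  rw [Finset.sdiff_inter_self_left] at h1
  rw [Finset.sdiff_inter_self_right] at h2
  rw [symmDiff_def, Finset.sup_eq_union, Finset.sum_union disjoint_sdiff_sdiff]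
  omega

/-- The neighbours of the origin in the triangular grid in cyclic order. -/
def triDir : Fin 6 → ℤ × ℤ := ![(1, 0), (0, 1), (-1, 1), (-1, 0), (0, -1), (1, -1)]

theorem sum_triNbr (g : ℤ × ℤ → ℕ) : ∑ t ∈ triNbr, g t = ∑ i, g (triDir i) := by
  have h : triNbr = univ.image triDir := by decide
  rw [h, Finset.sum_image]
  exact fun x _ y _ hxy => (by decide : Function.Injective triDir) hxy

/-- Two vertices with three detectors each have at most one detector in common. -/
theorem tri_common_le_one {S : Set (ℤ × ℤ)} (hS : IsErrOld TRI S) {v d : ℤ × ℤ} (hd : d ≠ 0)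
    (h1 : ∑ t ∈ triNbr, S.indicator (1 : ℤ × ℤ → ℕ) (v + t) = 3)
    (h2 : ∑ t ∈ triNbr, S.indicator (1 : ℤ × ℤ → ℕ) (v + d + t) = 3) :
    ∑ t ∈ triNbr ∩ triNbr.image (d + ·), S.indicator (1 : ℤ × ℤ → ℕ) (v + t) ≤ 1 := by
  have h3 := ((gridNorm_tri.isErrOld_iff_sum mem_triNbr S).1 hS).2 v d hd
  have h4 := sum_symmDiff_add triNbr (triNbr.image (d + ·))
    fun t => S.indicator (1 : ℤ × ℤ → ℕ) (v + t)
  rw [Finset.sum_image fun x _ y _ hxy => add_left_cancel hxy] at h4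
  simp only [← add_assoc] at h4
  omega

/-- Not all of five consecutive neighbours `w₀, …, w₄` of a detector `v` have exactly three
detectors. Otherwise any two of the `wⱼ` have only `v` as a common detector. This makes four of the
other neighbours of `w₂` non-detectors: `w₁` (common to `w₀` and `w₂`), `w₃` (common to `w₂` and
`w₄`), and the vertices that lie opposite `v` across the edges `w₁ w₂` and `w₂ w₃`. So `w₂` has at
most two detectors. -/
theorem tri_not_five_consecutive {S : Set (ℤ × ℤ)} (hS : IsErrOld TRI S) {v : ℤ × ℤ} (hv : v ∈ S)
    (i : Fin 6)
    (h : ∀ j ∈ ({0, 1, 2, 3, 4} : Finset (Fin 6)),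
      ∑ t ∈ triNbr, S.indicator (1 : ℤ × ℤ → ℕ) (v + triDir (i + j) + t) = 3) : False := by
  have hv1 : S.indicator (1 : ℤ × ℤ → ℕ) v = 1 := by simp [hv]
  -- the four non-detectors `v + q`, each with the two indices `j`, `k` for which it is a common
  -- neighbour of `wⱼ` and `wₖ`
  have geo : ∀ i : Fin 6, ∀ x ∈ [((0 : Fin 6), (2 : Fin 6), triDir (i + 1)),
      (2, 4, triDir (i + 3)), (1, 2, triDir (i + 2) + triDir (i + 1)),
      (2, 3, triDir (i + 2) + triDir (i + 3))],
      x.2.2 ≠ 0 ∧ triDir (i + x.1) ≠ triDir (i + x.2.1) ∧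
      x.2.2 - triDir (i + x.1) ∈ triNbr ∧ x.2.2 - triDir (i + x.2.1) ∈ triNbr ∧
      -triDir (i + x.1) ∈ triNbr ∧ -triDir (i + x.2.1) ∈ triNbr := by decide
  have key : ∀ j ∈ ({0, 1, 2, 3, 4} : Finset (Fin 6)), ∀ k ∈ ({0, 1, 2, 3, 4} : Finset (Fin 6)),
      ∀ q, (q ≠ 0 ∧ triDir (i + j) ≠ triDir (i + k) ∧
      q - triDir (i + j) ∈ triNbr ∧ q - triDir (i + k) ∈ triNbr ∧
      -triDir (i + j) ∈ triNbr ∧ -triDir (i + k) ∈ triNbr) →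
      S.indicator (1 : ℤ × ℤ → ℕ) (v + q) = 0 := by
    rintro j hj k hk q ⟨hq, hjk, a1, a2, a3, a4⟩
    have h1 := tri_common_le_one hS (v := v + triDir (i + j))
      (d := triDir (i + k) - triDir (i + j)) (sub_ne_zero.2 hjk.symm) (h j hj)
      (by rw [← h k hk]; congr 1; funext t; congr 1; abel)
    have hsub : ({q - triDir (i + j), -triDir (i + j)} : Finset (ℤ × ℤ)) ⊆ triNbr ∩
        triNbr.image (triDir (i + k) - triDir (i + j) + ·) := by
      intro x hx
      rw [Finset.mem_insert, Finset.mem_singleton] at hx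
      rw [Finset.mem_inter, Finset.mem_image]
      rcases hx with rfl | rfl
      · exact ⟨a1, _, a2, by abel⟩
      · exact ⟨a3, _, a4, by abel⟩
    have h2 := (Finset.sum_le_sum_of_subset
      (f := fun t => S.indicator (1 : ℤ × ℤ → ℕ) (v + triDir (i + j) + t)) hsub).trans h1
    rw [Finset.sum_pair (by simpa using hq)] at h2
    have e1 : v + triDir (i + j) + (q - triDir (i + j)) = v + q := by abel
    have e2 : v + triDir (i + j) + -triDir (i + j) = v := by abel
    rw [e1, e2, hv1] at h2
    omega
  have z1 := key 0 (by decide) 2 (by decide) (triDir (i + 1))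
    (geo i (0, 2, triDir (i + 1)) (by simp))
  have z2 := key 2 (by decide) 4 (by decide) (triDir (i + 3))
    (geo i (2, 4, triDir (i + 3)) (by simp))
  have z3 := key 1 (by decide) 2 (by decide) (triDir (i + 2) + triDir (i + 1))
    (geo i (1, 2, triDir (i + 2) + triDir (i + 1)) (by simp))
  have z4 := key 2 (by decide) 3 (by decide) (triDir (i + 2) + triDir (i + 3))
    (geo i (2, 3, triDir (i + 2) + triDir (i + 3)) (by simp))
  have h2 := h 2 (by decide)
  rw [sum_triNbr] at h2
  have hperm := Equiv.sum_comp (Equiv.addLeft i)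
    fun j => S.indicator (1 : ℤ × ℤ → ℕ) (v + triDir (i + 2) + triDir j)
  simp only [Equiv.coe_addLeft] at hperm
  rw [← hperm, Fin.sum_univ_six] at h2
  have e0 : ∀ i, triDir (i + 2) + triDir (i + 0) = triDir (i + 1) := by decide
  have e4 : ∀ i, triDir (i + 2) + triDir (i + 4) = triDir (i + 3) := by decide
  have b2 := indicator_one_le_one S (v + triDir (i + 2) + triDir (i + 2))
  have b5 := indicator_one_le_one S (v + triDir (i + 2) + triDir (i + 5))
  simp only [add_assoc, e0, e4] at h2 b2 b5
  omega

/-- A cyclic sequence of six values 3 or 4 without five consecutive 4s has at most four 4s. -/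
theorem sum_ite_le_of_not_five : ∀ p : Fin 6 → Bool,
    (∀ i, ¬ ∀ j ∈ ({0, 1, 2, 3, 4} : Finset (Fin 6)), p (i + j) = true) →
      ∑ i, (if p i then 4 else 3) ≤ 22 := by
  decide +kernel

/-- A vertex sends 4 to each neighbouring detector if it has exactly three, and 3 otherwise. -/
theorem tri_count {S : Set (ℤ × ℤ)} (hS : IsErrOld TRI S) (v : ℤ × ℤ) (r : ℕ) :
    6 * (ball TRI v r).ncard ≤ 11 * (S ∩ ball TRI v (r + 1)).ncard := by
  let k : ℤ × ℤ → ℕ := fun u => ∑ t ∈ triNbr, S.indicator (1 : ℤ × ℤ → ℕ) (u + t)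
  have hk : ∀ u, 3 ≤ k u := ((gridNorm_tri.isErrOld_iff_sum mem_triNbr S).1 hS).1
  have h := gridNorm_tri.discharging S triDir 1 (by decide)
    (fun i u => S.indicator 1 (u + triDir i) * if k u = 3 then 4 else 3) 12 22 ?_ ?_ v r
  · omega
  · intro u
    rw [← Finset.sum_mul, ← sum_triNbr fun t => S.indicator (1 : ℤ × ℤ → ℕ) (u + t)]
    have := hk u
    show 12 ≤ k u * _
    split_ifs <;> omega
  · intro w
    simp only [sub_add_cancel]
    rw [← Finset.mul_sum, mul_comm]
    by_cases hw : w ∈ S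
    · refine Nat.mul_le_mul_right _ ?_
      have h1 := sum_ite_le_of_not_five (fun i => k (w + triDir i) = 3) fun i hi =>
        tri_not_five_consecutive hS hw i fun j hj => by simpa using hi j hj
      have h2 := Equiv.sum_comp (Equiv.addLeft (3 : Fin 6))
        fun i => if k (w - triDir i) = 3 then 4 else 3
      rw [← h2]
      have h3 : ∀ i, w - triDir (3 + i) = w + triDir i := by
        intro i
        have : triDir (3 + i) = - triDir i := by revert i; decide
        rw [this, sub_neg_eq_add]
      simpa [h3] using h1
    · simp [hw]

/-! ### Discharging in the king grid -/

/-- The neighbours of the origin in the king grid in cyclic order; the diagonal ones have odd index,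
and the opposite of index `i` is `i + 4`. -/
def kngDir : Fin 8 → ℤ × ℤ :=
  ![(1, 0), (1, 1), (0, 1), (-1, 1), (-1, 0), (-1, -1), (0, -1), (1, -1)]

theorem sum_kngNbr (g : ℤ × ℤ → ℕ) : ∑ t ∈ kngNbr, g t = ∑ i, g (kngDir i) := by
  have h : kngNbr = univ.image kngDir := by decide
  rw [h, Finset.sum_image]
  exact fun x _ y _ hxy => (by decide : Function.Injective kngDir) hxy

/-- The number of ones among the lowest eight binary digits. -/
def bitCount (P : ℕ) : ℕ := ∑ j : Fin 8, P / 2 ^ (j : ℕ) % 2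

/-- The units that a vertex with `k` neighbouring detectors sends to each of them if it treats them
alike: `180 / k` for `k = 3, 4, 5`, and 30 for `k ≥ 6`. Fewer than three do not occur. -/
def evenShare (k : ℕ) : ℕ := if k ≤ 3 then 60 else if k = 4 then 45 else if k = 5 then 36 else 30

/-- The units that a vertex sends to the detector at its neighbour of index `i`. The pattern `P` of
its neighbouring detectors is read off cyclically from that neighbour, which is bit 0, so that only
the parity of `i` matters. Each list is closed under reflection, which fixes bit 0. The exceptional
arrangements are those of the indices `1, 3, 5` (where 3 gets 70 and the others 55), `1, 2, 5` (61,
65 and 54) and `0, 2, 3, 5` (39, 45, 44 and 52), up to symmetry. -/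
def kngShare (i P : ℕ) : ℕ :=
  if i % 2 = 0 then
    if P ∈ [0b00100011, 0b10001001] then 65
    else if P ∈ [0b00101101, 0b01101001] then 39
    else evenShare (bitCount P)
  else
    if P ∈ [0b01000101] then 70
    else if P ∈ [0b00010101, 0b01010001] then 55
    else if P ∈ [0b00010011, 0b10010001] then 61
    else if P ∈ [0b00011001, 0b00110001] then 54
    else if P ∈ [0b01001011, 0b10100101] then 44
    else if P ∈ [0b00101101, 0b01101001] then 52
    else evenShare (bitCount P)

/-- The pattern of the detectors around `u` with the neighbour of index `i` as bit 0; `s` is the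
indicator function of the set of detectors. -/
def kngCode (s : ℤ × ℤ → ℕ) (u : ℤ × ℤ) (i : Fin 8) : ℕ :=
  ∑ j : Fin 8, 2 ^ (j : ℕ) * s (u + kngDir (i + j))

/-- Every vertex sends at least 180 units: a check of the 256 patterns. -/
theorem le_sum_share_bool : ∀ b : Fin 8 → Bool, 3 ≤ ∑ i, (b i).toNat →
    180 ≤ ∑ i, (b i).toNat * kngShare i (∑ j : Fin 8, 2 ^ (j : ℕ) * (b (i + j)).toNat) := by
  decide +kernel

theorem bitCount_bool : ∀ b : Fin 8 → Bool,
    bitCount (∑ j : Fin 8, 2 ^ (j : ℕ) * (b j).toNat) = ∑ j, (b j).toNat := by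
  decide +kernel

theorem toNat_decide_eq_one {s : ℤ × ℤ → ℕ} (hs : ∀ p, s p ≤ 1) (p : ℤ × ℤ) :
    (decide (s p = 1)).toNat = s p := by
  have := hs p
  interval_cases s p <;> rfl

theorem le_sum_share {s : ℤ × ℤ → ℕ} (hs : ∀ p, s p ≤ 1) (u : ℤ × ℤ)
    (hu : 3 ≤ ∑ i, s (u + kngDir i)) :
    180 ≤ ∑ i, s (u + kngDir i) * kngShare i (kngCode s u i) := by
  have h := le_sum_share_bool fun i => decide (s (u + kngDir i) = 1)
  simp only [toNat_decide_eq_one hs] at h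
  exact h hu

theorem bitCount_kngCode {s : ℤ × ℤ → ℕ} (hs : ∀ p, s p ≤ 1) (u : ℤ × ℤ) (i : Fin 8) :
    bitCount (kngCode s u i) = ∑ j, s (u + kngDir j) := by
  have h := bitCount_bool fun j => decide (s (u + kngDir (i + j)) = 1)
  simp only [toNat_decide_eq_one hs] at h
  rw [kngCode, h]
  exact Equiv.sum_comp (Equiv.addLeft i) fun j => s (u + kngDir j)

/-! ### Counters packed into one number -/

/-- The number with the digits `a 0, …, a (m - 1)` to base 256, lowest digit first. The definition
does not require that `a f < 256`. -/
def pack : ℕ → (ℕ → ℕ) → ℕ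
  | 0, _ => 0
  | m + 1, a => a 0 + 256 * pack m fun f => a (f + 1)

theorem pack_congr {m : ℕ} {a b : ℕ → ℕ} (h : ∀ f < m, a f = b f) : pack m a = pack m b := by
  induction m generalizing a b with
  | zero => rfl
  | succ m ih =>
    rw [pack, pack, h 0 m.succ_pos, ih fun f hf => h (f + 1) (Nat.succ_lt_succ hf)]

theorem pack_add (m : ℕ) (a b : ℕ → ℕ) : pack m (fun f => a f + b f) = pack m a + pack m b := by
  induction m generalizing a b with
  | zero => rfl
  | succ m ih =>
    rw [pack, pack, pack, ih]
    ring

theorem pack_mul (m c : ℕ) (a : ℕ → ℕ) : pack m (fun f => c * a f) = c * pack m a := by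
  induction m generalizing a with
  | zero => rfl
  | succ m ih =>
    rw [pack, pack, ih]
    ring

/-- The kernel evaluates `Nat.land` and `Nat.shiftRight` directly on literals. -/
theorem pack_digit {m : ℕ} {a : ℕ → ℕ} (h : ∀ f < m, a f < 256) {f : ℕ} (hf : f < m) :
    Nat.land (Nat.shiftRight (pack m a) (8 * f)) 255 = a f := by
  change (pack m a >>> (8 * f)) &&& (2 ^ 8 - 1) = a f
  rw [Nat.and_two_pow_sub_one_eq_mod, Nat.shiftRight_eq_div_pow, pow_mul]
  induction f generalizing m a with
  | zero =>
    obtain ⟨m, rfl⟩ := Nat.exists_eq_succ_of_ne_zero hf.ne'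
    have := h 0 hf
    rw [pack]
    omega
  | succ f ih =>
    obtain ⟨m, rfl⟩ := Nat.exists_eq_succ_of_ne_zero (Nat.ne_zero_of_lt hf)
    have h0 := h 0 m.succ_pos
    have h1 : (a 0 + 256 * pack m fun f => a (f + 1)) / 2 ^ 8 = pack m fun f => a (f + 1) := by
      omega
    rw [pack, pow_succ', ← Nat.div_div_eq_div_mul, h1]
    exact ih (fun g hg => h (g + 1) (Nat.succ_lt_succ hg)) (Nat.lt_of_succ_lt_succ hf)

theorem land_pack {m : ℕ} {a b : ℕ → ℕ} (ha : ∀ f < m, a f < 256) (hb : ∀ f < m, b f < 256) :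
    Nat.land (pack m a) (pack m b) = pack m fun f => Nat.land (a f) (b f) := by
  induction m generalizing a b with
  | zero => exact Nat.zero_and 0
  | succ m ih =>
    have ha0 := ha 0 m.succ_pos
    have hb0 := hb 0 m.succ_pos
    have h1 := Nat.and_div_two_pow (a := pack (m + 1) a) (b := pack (m + 1) b) (n := 8)
    have h2 := Nat.and_mod_two_pow (a := pack (m + 1) a) (b := pack (m + 1) b) (n := 8)
    have e1 : pack (m + 1) a / 2 ^ 8 = pack m fun f => a (f + 1) := by rw [pack]; omega
    have e2 : pack (m + 1) b / 2 ^ 8 = pack m fun f => b (f + 1) := by rw [pack]; omega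
    have e3 : pack (m + 1) a % 2 ^ 8 = a 0 := by rw [pack]; omega
    have e4 : pack (m + 1) b % 2 ^ 8 = b 0 := by rw [pack]; omega
    have h3 : (pack m fun f => a (f + 1)) &&& (pack m fun f => b (f + 1)) =
        pack m fun f => Nat.land (a (f + 1)) (b (f + 1)) :=
      ih (fun f hf => ha (f + 1) (Nat.succ_lt_succ hf))
        (fun f hf => hb (f + 1) (Nat.succ_lt_succ hf))
    rw [e1, e2, h3] at h1
    rw [e3, e4] at h2
    change pack (m + 1) a &&& pack (m + 1) b =
      (a 0 &&& b 0) + 256 * pack m fun f => Nat.land (a (f + 1)) (b (f + 1))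
    omega

/-- Since `256 ≡ 1` modulo 255, the digit sum is found by one division. -/
theorem pack_mod {m : ℕ} (a : ℕ → ℕ) : pack m a % 255 = (∑ f ∈ range m, a f) % 255 := by
  induction m generalizing a with
  | zero => rfl
  | succ m ih =>
    have h := ih fun f => a (f + 1)
    rw [pack, Finset.sum_range_succ']
    omega

theorem land_128 : ∀ x < 256, Nat.land x 128 = if 128 ≤ x then 128 else 0 := by
  decide +kernel

/-! ### Branch and bound over the square of side five -/

/-- Whether `p` is a neighbour of `c` in the king grid. -/
def kngNear (c p : ℤ × ℤ) : Bool := kngNorm (p - c) == 1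

/-- The neighbours of the origin, in cyclic order, and the origin itself. -/
def kngCenters : List (ℤ × ℤ) := List.ofFn kngDir ++ [0]

/-- The 45 regions of the square `[-2, 2] × [-2, 2]` that contain at least three detectors: the
neighbourhoods of the nine `kngCenters`, then their pairwise symmetric differences. -/
def kngRegions : List (ℤ × ℤ → Bool) :=
  kngCenters.map kngNear ++ (List.range 9).flatMap fun i => (List.range i).map fun j p =>
    kngNear (kngCenters.getD i 0) p ^^ kngNear (kngCenters.getD j 0) p

/-- The contribution of a detector at `p` to the pattern around `kngDir i`, seen from the recipient
at the origin, which is the neighbour of index `i + 4` of `kngDir i`. -/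
def codeBit (i : Fin 8) (p : ℤ × ℤ) : ℕ :=
  ∑ j : Fin 8, 2 ^ (j : ℕ) * if kngDir i + kngDir (i + 4 + j) = p then 1 else 0

/-- The contribution of a detector at `p` to the 53 counters of the search: the counters `f < 45`
count the detectors in the regions, and the counter `45 + i` is the pattern around `kngDir i`. The
first eight regions are the neighbourhoods of the `kngDir i`, so counter `i` is the number of
detectors around `kngDir i`. -/
def cellVec (p : ℤ × ℤ) (f : ℕ) : ℕ :=
  if f < 45 then (kngRegions.getD f (fun _ => false) p).toNat else codeBit (Fin.ofNat 8 (f - 45)) p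

/-- One level of the search tree, on which it is decided whether a cell contains a detector. -/
structure SearchStep where
  /-- The cell to be decided. -/
  cell : ℤ × ℤ
  /-- The packed counters that a detector in this cell contributes. -/
  inc : ℕ
  /-- The indices of the neighbours of the origin all of whose neighbours are decided after this
  step. -/
  done : List ℕ

/-- The bytes 128 for the 45 regions. -/
def legalMask : ℕ :=
  0x808080808080808080808080808080808080808080808080808080808080808080808080808080808080808080

/-- The bytes 128 for the neighbourhoods of the eight neighbours of the origin. -/
def countMask : ℕ := 0x8080808080808080

/-- Byte `P` is the slack of the pattern `P` for a non-diagonal neighbour: what the origin receives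
for this pattern falls short of the bound `windowCap` by this amount. -/
def evenSlack : ℕ :=
  0x70000000000000007000000070007070a0000000000000007000000070007070a000000070007070a0007070a070a0a0a0000000000000007000000070007070a000000070007070a0007070a070a0a0a000000070007070a0007070a070a0a0a0007070a070a050a070a0a0a0a0a0a0a0000000000000007000000070007070a0000000700070d0a0007070a070a0a0a000000070007070a0007070a070a0a0a0007070a070a0a0a070a0a0a0a0a0a0a000000070007070a0007070a070a0a0a00070d0a070a0a0a070a0a0a050a0a0a0007070a070a0a0a070a0a0a0a0a0a0a070a0a0a0a0a0a0a0a0a0a0a0a0a0a0a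

/-- Byte `P` is the slack of the pattern `P` for a diagonal neighbour. -/
def oddSlack : ℕ :=
  0x70000000000000007000000070007070a0000000000000007000000070007070a000000070007070a0007070a070a0a0a0000000000000007000000070007070a000000070007070a0007080a070a0a0a000000070007070a0007070a070a090a0007070a070a0a0a070a0a0a0a0a0a0a0000000000000007000000070007070a000000070007000a0007070a070a0a0a000000070007070a0007070a070a0f0a0007070a080a0a0a070a000a0a0a0a0a000000070007070a0007070a070a100a0007000a070a0a0a070a0a0a0a0a0a0a0007070a070a100a070a0f0a090a0a0a070a0a0a0a0a0a0a0a0a0a0a0a0a0a0a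

/-- The slack of the neighbour of index `i` for the pattern in the packed counters `st`. Here and
below, the functions of `Nat` are named explicitly and recursion is by recursors, so that evaluation
in the kernel does not unfold instances or compiled recursion. -/
def slackAt (st i : ℕ) : ℕ :=
  Nat.land (Nat.shiftRight (cond (Nat.beq (Nat.mod i 2) 0) evenSlack oddSlack)
    (Nat.mul 8 (Nat.land (Nat.shiftRight st (Nat.mul 8 (Nat.add i 45))) 255))) 255

/-- The slack `acc` increased by that of the neighbours in the list `l`. -/
noncomputable def addSlack (st acc : ℕ) (l : List ℕ) : ℕ :=
  List.rec acc (fun i _ r => Nat.add r (slackAt st i)) l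

/-- The number of neighbours of the origin with at least `k` detectors around them so far, if `thr`
consists of eight bytes `128 - k`: after adding `thr`, a byte has its highest bit set if and only if
the counter is at least `k`, and these bits are summed up modulo 255. -/
def countGE (thr st : ℕ) : ℕ :=
  Nat.mod (Nat.shiftRight (Nat.land (Nat.add st thr) countMask) 7) 255

/-- Whether the bound 415 is already forced. At the start, the origin may receive up to 70 from each
neighbour, 560 in total. A neighbour with at least four, five or six detectors sends at most 52, 36
or 30 units, which saves 18, 16 more and 6 more. If these savings and the slack `acc` of the
completed neighbours add up to `560 - 415 = 145`, the bound holds. -/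
def bounded (st acc : ℕ) : Bool :=
  Nat.ble 145 (Nat.add acc (Nat.add (Nat.mul 18 (countGE 0x7c7c7c7c7c7c7c7c st))
    (Nat.add (Nat.mul 16 (countGE 0x7b7b7b7b7b7b7b7b st))
      (Nat.mul 6 (countGE 0x7a7a7a7a7a7a7a7a st)))))

/-- Whether all 45 regions can still get three detectors, where `hi` is as in `searchStep`. -/
def legal (hi : ℕ) : Bool := Nat.beq (Nat.land hi legalMask) legalMask

/-- A node of the search. Here `st` are the packed counters of the detectors placed so far, `acc` is
the slack collected so far, and `hi` are the packed counters with all undecided cells counted as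
detectors, where 125 has been added to the 45 counts; so a region can still get three detectors if
and only if its byte in `hi` is at least 128. The recursive call `visit` is made for the cell
without a detector, unless this is not legal, and for the cell with a detector. -/
noncomputable def searchStep (p : SearchStep) (visit : ℕ → ℕ → ℕ → Bool) (st hi acc : ℕ) : Bool :=
  cond (bounded st acc) true
    (cond (cond (legal (Nat.sub hi p.inc))
        (visit st (Nat.sub hi p.inc) (addSlack st acc p.done)) true)
      (visit (Nat.add st p.inc) hi (addSlack (Nat.add st p.inc) acc p.done)) false)

/-- The branch and bound over the cells in `l`: whether each branch ends illegally or with the bound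
forced. -/
noncomputable def search (l : List SearchStep) : ℕ → ℕ → ℕ → Bool :=
  List.rec (fun st _ acc => bounded st acc) (fun p _ ih => searchStep p ih) l

/-- The 24 cells around the origin. The order decides the inner cells first, because they occur in
the largest number of regions. -/
noncomputable def searchSteps : List SearchStep := [
  ⟨(-1, -1), 0x4004000000000010001000101010101000100000000010001010101010000000001010101000000000000010001000100000000, []⟩,
  ⟨(0, -1), 0x200808000000002000100000101010001000001010100010100000001000101010001010100000001000101010100010100000001, []⟩,
  ⟨(1, -1), 0x40000000000004010001010101010001000000000001010101010100000000000100000001000001000101010001000000000001, []⟩,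
  ⟨(1, 0), 0x8080000000020200000001010100000100010101000001010101000001000001010000010100010100000101010101000000010100, []⟩,
  ⟨(1, 1), 0x40040010101010100010000000000010001000000010001000001000100010001010001010001010000000000010001, []⟩,
  ⟨(0, 1), 0x202008080010101000001000000000101000101000101000101010100010100010000010000010100010000000101000101, []⟩,
  ⟨(-1, 1), 0x400400000010101000100010100000100010000000100010000010001000001000101010000010100010000000100010000, []⟩,
  ⟨(-1, 0), 0x2020080800000010000010000010101010001010000000100000101010000010101010000000101010100010001010001010000, []⟩,
  ⟨(2, 0), 0x4000000000000410010000000000010101010101010000000000000101000000010100000101000101010100000100000000000101, []⟩,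
  ⟨(-1, -2), 0x8200000000000000101000000000001010000000000000101010101010101010100000000000000000000000001010000000000, []⟩,
  ⟨(0, -2), 0x410400000000000010101000000000000000101010101000101010101010101010100000000000000000000000101010000000000, []⟩,
  ⟨(1, -2), 0x820000000000000010100000000000000010101010101010101010101000000000000000000000000000000000101000000000000, [6]⟩,
  ⟨(2, -1), 0x2000000000000008010000000000000101010101010100000000000001000000000100000001000001000101000100000000000001, []⟩,
  ⟨(-2, -1), 0x82000000000000001010000000000010100000000010100000000000101010101010101000000000000000000010100000000, []⟩,
  ⟨(-2, 0), 0x41040000000000001010100000000010101000000010101000000000001010100010101010101000000000000010101000000, []⟩,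
  ⟨(2, 1), 0x820000000000000010100000000000101000000000101000000010100000101000101010100000000000000000101, [0]⟩,
  ⟨(-2, 1), 0x820000000000000010100000000000101000000000101000000010100000000010101010101000000000000000101000000, [4]⟩,
  ⟨(2, -2), 0x1000000000000000010000000000000001010101010101000000000000000000000000000000000000000000000100000000000000, [7]⟩,
  ⟨(-2, -2), 0x100000000000000001000000000000010000000000010000000000010101010100000000000000000000000000010000000000, [5]⟩,
  ⟨(0, 2), 0x4104000000000000101010000000001010100000001010100000101010001010100000001000101000000000001010100, []⟩,
  ⟨(1, 2), 0x82000000000000001010000000000010100000000010100000001010000010100010100000101000000000000010100, []⟩,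
  ⟨(-1, 2), 0x8200000000000000101000000000001010000000001010000000101000001010000000101010100000000000001010000, [2]⟩,
  ⟨(-2, 2), 0x10000000000000000100000000000001000000000001000000000100000001000000010101000000000000000001000000, [3]⟩,
  ⟨(2, 2), 0x1000000000000000010000000000000100000000000100000000010000000100000100010001000000000000000100, [1]⟩]

/-- The search succeeds from the node at which only the origin, a detector, is decided. -/
theorem search_eq_true :
    search searchSteps
      0x101010101010101010101010101010100000000000000000000000000000000000000000000000000000000000101010101010101
      0xffffffffffffffff89858985898589858587898b8987858589898789898587898b8985898987858789858985858585858585858585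
      0 = true := by
  decide +kernel

/-! ### Soundness of the search -/

/-- A bound for the share that a detector gets from a vertex with `k` neighbouring detectors. -/
def windowCap (k : ℕ) : ℕ := if k ≤ 3 then 70 else if k = 4 then 52 else if k = 5 then 36 else 30

theorem legalMask_eq : legalMask = pack 53 fun f => if f < 45 then 128 else 0 := by
  decide +kernel

theorem countMask_eq : countMask = pack 53 fun f => if f < 8 then 128 else 0 := by
  decide +kernel

/-- The tables contain what their names say; in particular, shares are bounded by `windowCap`. -/
theorem slack_eq : ∀ P < 256, ∀ i < 8, kngShare i P +
    Nat.land (Nat.shiftRight (cond (Nat.beq (Nat.mod i 2) 0) evenSlack oddSlack)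
      (Nat.mul 8 P)) 255 = windowCap (bitCount P) := by
  decide +kernel

theorem legal_pack {h : ℕ → ℕ} (h1 : ∀ f < 53, h f < 256) (h2 : ∀ f < 45, 128 ≤ h f) :
    legal (pack 53 h) = true := by
  rw [legal, Nat.beq_eq]
  rw [legalMask_eq, land_pack h1 fun f _ => by split_ifs <;> omega]
  refine pack_congr fun f hf => ?_
  split_ifs with h45
  · rw [land_128 _ (h1 f hf), if_pos (h2 f h45)]
  · exact Nat.and_zero _

theorem countGE_pack {a : ℕ → ℕ} {c k : ℕ} (ha : ∀ f < 53, a f < 256) (hk : k ≤ 128)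
    (hc : c = pack 53 fun f => if f < 8 then 128 - k else 0)
    (hak : ∀ f < 8, a f + (128 - k) < 256) :
    countGE c (pack 53 a) = ∑ f ∈ range 8, if k ≤ a f then 1 else 0 := by
  have h1 : Nat.land (Nat.add (pack 53 a) c) countMask =
      128 * pack 53 fun f => if f < 8 ∧ k ≤ a f then 1 else 0 := by
    have h2 : Nat.add (pack 53 a) c = pack 53 fun f => a f + if f < 8 then 128 - k else 0 := by
      rw [pack_add, ← hc]; rfl
    rw [h2, countMask_eq, land_pack, ← pack_mul]
    · refine pack_congr fun f hf => ?_
      by_cases h8 : f < 8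
      · have h3 := hak f h8
        rw [if_pos h8, if_pos h8, land_128 _ h3]
        by_cases h4 : k ≤ a f
        · rw [if_pos (by omega), if_pos ⟨h8, h4⟩]
        · rw [if_neg (by omega), if_neg fun h => h4 h.2]
      · rw [if_neg h8, if_neg h8, if_neg fun h => h8 h.1]
        exact Nat.and_zero _
    · intro f hf
      split_ifs with h8
      · exact hak f h8
      · exact ha f hf
    · intro f _
      split_ifs <;> omega
  have h2 : ∑ f ∈ range 53, (if f < 8 ∧ k ≤ a f then 1 else 0) =
      ∑ f ∈ range 8, if k ≤ a f then 1 else 0 := by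
    rw [← Finset.sum_subset (Finset.range_subset_range.2 (by norm_num : 8 ≤ 53))]
    · refine Finset.sum_congr rfl fun f hf => ?_
      simp only [Finset.mem_range.1 hf, true_and]
    · intro f _ hf
      rw [if_neg fun h => hf (Finset.mem_range.2 h.1)]
  have h3 : ∑ f ∈ range 8, (if k ≤ a f then 1 else 0) ≤ 8 := by
    refine (Finset.sum_le_card_nsmul (range 8) _ 1 fun f _ => ?_).trans (by simp)
    split_ifs <;> omega
  rw [countGE, h1]
  change (128 * _) >>> 7 % 255 = _
  rw [Nat.shiftRight_eq_div_pow, Nat.mul_div_cancel_left _ (by norm_num), pack_mod, h2]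
  omega

/-- The savings in `bounded` are the differences of consecutive values of `windowCap`. -/
theorem windowCap_add (k : ℕ) : windowCap k + (18 * (if 4 ≤ k then 1 else 0) +
    (16 * (if 5 ≤ k then 1 else 0) + 6 * (if 6 ≤ k then 1 else 0))) = 70 := by
  unfold windowCap
  split_ifs <;> omega

/-- If the slack collected so far and the counts reached so far force the bound, the bound holds. -/
theorem sum_le_of_bounded {a F w σ : ℕ → ℕ} {acc : ℕ} (ha : ∀ f < 53, a f < 256)
    (ha' : ∀ f < 8, a f ≤ 130) (haF : ∀ f < 8, a f ≤ F f)
    (hw : ∀ f < 8, w f + σ f = windowCap (F f)) (hacc : acc ≤ ∑ f ∈ range 8, σ f)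
    (hb : bounded (pack 53 a) acc = true) : ∑ f ∈ range 8, w f ≤ 415 := by
  have hb' := Nat.le_of_ble_eq_true hb
  rw [countGE_pack (k := 4) ha (by norm_num) (by decide +kernel)
      (fun f hf => by have := ha' f hf; omega),
    countGE_pack (k := 5) ha (by norm_num) (by decide +kernel)
      (fun f hf => by have := ha' f hf; omega),
    countGE_pack (k := 6) ha (by norm_num) (by decide +kernel)
      (fun f hf => by have := ha' f hf; omega)] at hb'
  have mono : ∀ k, ∑ f ∈ range 8, (if k ≤ a f then 1 else 0) ≤
      ∑ f ∈ range 8, if k ≤ F f then 1 else 0 := by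
    intro k
    refine Finset.sum_le_sum fun f hf => ?_
    have := haF f (Finset.mem_range.1 hf)
    split_ifs <;> omega
  have hcap : ∑ f ∈ range 8, windowCap (F f) + (18 * ∑ f ∈ range 8, (if 4 ≤ F f then 1 else 0) +
      (16 * ∑ f ∈ range 8, (if 5 ≤ F f then 1 else 0) +
        6 * ∑ f ∈ range 8, if 6 ≤ F f then 1 else 0)) = 560 := by
    rw [Finset.mul_sum, Finset.mul_sum, Finset.mul_sum, ← Finset.sum_add_distrib,
      ← Finset.sum_add_distrib, ← Finset.sum_add_distrib,
      Finset.sum_congr rfl fun f _ => windowCap_add (F f)]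
    rfl
  have hsum : ∑ f ∈ range 8, w f + ∑ f ∈ range 8, σ f = ∑ f ∈ range 8, windowCap (F f) := by
    rw [← Finset.sum_add_distrib]
    exact Finset.sum_congr rfl fun f hf => hw f (Finset.mem_range.1 hf)
  have m4 := mono 4
  have m5 := mono 5
  have m6 := mono 6
  change 145 ≤ acc + (18 * _ + (16 * _ + 6 * _)) at hb'
  omega

/-- The data in the steps are correct: the increments are the packed contributions of the cells, and
no cell decided later contributes to a pattern that is marked as completed. -/
def ValidSteps (l : List SearchStep) : Prop :=
  (∀ p ∈ l, p.inc = pack 53 (cellVec p.cell)) ∧ (∀ p ∈ l, ∀ i ∈ p.done, i < 8) ∧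
    l.Pairwise fun p q => ∀ i ∈ p.done, cellVec q.cell (45 + i) = 0

theorem addSlack_eq {st acc : ℕ} {l : List ℕ} {σ : ℕ → ℕ} (h : ∀ i ∈ l, slackAt st i = σ i) :
    addSlack st acc l = acc + (l.map σ).sum := by
  induction l with
  | nil => rfl
  | cons i l ih =>
    have h1 := ih fun j hj => h j (List.mem_cons_of_mem _ hj)
    have h2 := h i List.mem_cons_self
    change addSlack st acc l + slackAt st i = _
    rw [h1, h2, List.map_cons, List.sum_cons]
    omega

theorem slackAt_pack {a F : ℕ → ℕ} (ha : ∀ f < 53, a f < 256) {i : ℕ} (hi : i < 8)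
    (haF : a (45 + i) = F (45 + i)) {w : ℕ → ℕ} (hw : w i = kngShare i (F (45 + i))) :
    w i + slackAt (pack 53 a) i = windowCap (bitCount (F (45 + i))) := by
  have h1 := pack_digit ha (f := i + 45) (by omega)
  have h2 := slack_eq (F (45 + i)) (haF ▸ ha _ (by omega)) i hi
  rw [hw, ← h2]
  unfold slackAt
  change _ + Nat.land (Nat.shiftRight _ (Nat.mul 8 (Nat.land (Nat.shiftRight (pack 53 a)
    (8 * (i + 45))) 255))) 255 = _
  rw [h1, add_comm i 45, haF]

/-- If the search succeeds, the bound holds for every configuration `x` that is compatible with the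
node. The counters `F` of the full configuration are those of the node plus the contributions of the
undecided cells; they satisfy the 45 conditions. The slack collected at the node and that of the
patterns not yet completed do not exceed the total slack. -/
theorem search_sound {x : ℤ × ℤ → ℕ} (hx : ∀ p, x p ≤ 1) {F : ℕ → ℕ} (hF3 : ∀ f < 45, 3 ≤ F f)
    (hcode : ∀ i < 8, bitCount (F (45 + i)) = F i) (l : List SearchStep) (hl : ValidSteps l) :
    ∀ (a h : ℕ → ℕ) (acc : ℕ),
      (∀ f, F f = a f + (l.map fun p => x p.cell * cellVec p.cell f).sum) →
      (∀ f < 53, h f = (if f < 45 then 125 else 0) +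
        (a f + (l.map fun p => cellVec p.cell f).sum)) →
      (∀ f < 53, h f < 256) →
      acc + ((l.flatMap SearchStep.done).map fun i =>
        windowCap (F i) - kngShare i (F (45 + i))).sum ≤
          ∑ i ∈ range 8, (windowCap (F i) - kngShare i (F (45 + i))) →
      search l (pack 53 a) (pack 53 h) acc = true →
      ∑ i ∈ range 8, kngShare i (F (45 + i)) ≤ 415 := by
  have hbound : ∀ (l : List SearchStep) (a h : ℕ → ℕ) (acc : ℕ),
      (∀ f, F f = a f + (l.map fun p => x p.cell * cellVec p.cell f).sum) →
      (∀ f < 53, h f = (if f < 45 then 125 else 0) +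
        (a f + (l.map fun p => cellVec p.cell f).sum)) →
      (∀ f < 53, h f < 256) →
      acc ≤ ∑ i ∈ range 8, (windowCap (F i) - kngShare i (F (45 + i))) →
      bounded (pack 53 a) acc = true → ∑ i ∈ range 8, kngShare i (F (45 + i)) ≤ 415 := by
    intro l a h acc hF hh h256 hacc hb
    have hFlt : ∀ f < 53, F f < 256 := by
      intro f hf
      have h1 : (l.map fun p => x p.cell * cellVec p.cell f).sum ≤
          (l.map fun p => cellVec p.cell f).sum :=
        List.sum_le_sum fun p _ => (Nat.mul_le_mul_right _ (hx _)).trans (one_mul _).le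
      have h2 := hh f hf
      have h3 := h256 f hf
      have h4 := hF f
      omega
    refine sum_le_of_bounded (F := F) (fun f hf => ?_) (fun f hf => ?_) (fun f _ => ?_)
      (fun f hf => ?_) hacc hb
    · have := hh f hf; have := h256 f hf; omega
    · have h1 := hh f (by omega); have h2 := h256 f (by omega)
      rw [if_pos (by omega)] at h1
      omega
    · rw [hF f]; omega
    · have := slack_eq (F (45 + f)) (hFlt _ (by omega)) f hf
      rw [hcode f hf] at this
      exact Nat.add_sub_cancel' (by omega)
  induction l with
  | nil =>
    intro a h acc hF hh h256 hacc hs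
    exact hbound [] a h acc hF hh h256 (by simpa using hacc) hs
  | cons p l ih =>
    intro a h acc hF hh h256 hacc hs
    obtain ⟨hinc, hdone, hpair⟩ := hl
    have hl' : ValidSteps l := ⟨fun q hq => hinc q (List.mem_cons_of_mem _ hq),
      fun q hq => hdone q (List.mem_cons_of_mem _ hq), (List.pairwise_cons.1 hpair).2⟩
    have hp := hinc p List.mem_cons_self
    have hpd := hdone p List.mem_cons_self
    have hpl := (List.pairwise_cons.1 hpair).1
    by_cases hb : bounded (pack 53 a) acc = true
    · exact hbound (p :: l) a h acc hF hh h256 (by omega) hb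
    -- the patterns completed by this step are final, and so is the slack read off from them
    have hdig : ∀ (b : ℕ → ℕ), (∀ f < 53, b f < 256) →
        (∀ f, F f = b f + (l.map fun q => x q.cell * cellVec q.cell f).sum) →
        addSlack (pack 53 b) acc p.done + ((l.flatMap SearchStep.done).map fun i =>
          windowCap (F i) - kngShare i (F (45 + i))).sum ≤
          ∑ i ∈ range 8, (windowCap (F i) - kngShare i (F (45 + i))) := by
      intro b hb hFb
      rw [addSlack_eq (σ := fun i => windowCap (F i) - kngShare i (F (45 + i)))]
      · rw [List.flatMap_cons, List.map_append, List.sum_append] at hacc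
        omega
      · intro i hi
        have hz : (l.map fun q => x q.cell * cellVec q.cell (45 + i)).sum = 0 := by
          rw [List.sum_eq_zero_iff]
          intro y hy
          obtain ⟨q, hq, rfl⟩ := List.mem_map.1 hy
          rw [hpl q hq i hi, mul_zero]
        have h1 := slackAt_pack (F := F) hb (hpd i hi) (by rw [hFb, hz, add_zero])
          (w := fun i => kngShare i (F (45 + i))) rfl
        rw [hcode i (hpd i hi)] at h1
        rw [← h1, Nat.add_sub_cancel_left]
    have hstep : searchStep p (search l) (pack 53 a) (pack 53 h) acc = true := hs
    rw [searchStep, Bool.eq_false_iff.2 hb, cond_false] at hstep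
    simp only [List.map_cons, List.sum_cons] at hF hh
    have h01 : x p.cell = 0 ∨ x p.cell = 1 := by have := hx p.cell; omega
    rcases h01 with h0 | h1
    · -- no detector in this cell: its contribution is removed from the upper counters
      have hh' : ∀ f < 53, h f - cellVec p.cell f =
          (if f < 45 then 125 else 0) + (a f + (l.map fun p => cellVec p.cell f).sum) := by
        intro f hf
        have := hh f hf
        omega
      have hsub : Nat.sub (pack 53 h) p.inc = pack 53 fun f => h f - cellVec p.cell f := by
        have h2 : pack 53 h = pack 53 (fun f => h f - cellVec p.cell f) +
            pack 53 (cellVec p.cell) := by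
          rw [← pack_add]
          refine pack_congr fun f hf => ?_
          have := hh f hf
          omega
        rw [h2, hp]
        exact Nat.add_sub_cancel _ _
      have hFa : ∀ f, F f = a f + (l.map fun q => x q.cell * cellVec q.cell f).sum := by
        intro f
        rw [hF f, h0, zero_mul, zero_add]
      have h256' : ∀ f < 53, h f - cellVec p.cell f < 256 :=
        fun f hf => (Nat.sub_le _ _).trans_lt (h256 f hf)
      have hlegal : legal (Nat.sub (pack 53 h) p.inc) = true := by
        rw [hsub]
        refine legal_pack h256' fun f hf => ?_
        have h2 : (l.map fun q => x q.cell * cellVec q.cell f).sum ≤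
            (l.map fun q => cellVec q.cell f).sum :=
          List.sum_le_sum fun q _ => (Nat.mul_le_mul_right _ (hx _)).trans (one_mul _).le
        have h3 := hh' f (by omega)
        have h4 := hFa f
        have h5 := hF3 f hf
        rw [if_pos hf] at h3
        omega
      rw [hlegal, cond_true] at hstep
      have hrec : search l (pack 53 a) (Nat.sub (pack 53 h) p.inc)
          (addSlack (pack 53 a) acc p.done) = true := by
        by_contra hne
        rw [Bool.eq_false_iff.2 hne] at hstep
        exact absurd hstep (by simp)
      rw [hsub] at hrec
      refine ih hl' a _ _ hFa hh' h256' (hdig a (fun f hf => ?_) hFa) hrec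
      have := hh f hf
      have := h256 f hf
      omega
    · have hadd : Nat.add (pack 53 a) p.inc = pack 53 fun f => a f + cellVec p.cell f := by
        rw [pack_add, hp]; rfl
      have hFa : ∀ f, F f = a f + cellVec p.cell f +
          (l.map fun q => x q.cell * cellVec q.cell f).sum := by
        intro f
        rw [hF f, h1, one_mul, add_assoc]
      have hrec : search l (Nat.add (pack 53 a) p.inc) (pack 53 h)
          (addSlack (Nat.add (pack 53 a) p.inc) acc p.done) = true := by
        by_contra hne
        rw [Bool.eq_false_iff.2 hne] at hstep
        revert hstep
        cases (cond (legal ((pack 53 h).sub p.inc)) (search l (pack 53 a) ((pack 53 h).sub p.inc)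
          (addSlack (pack 53 a) acc p.done)) true) <;> simp
      rw [hadd] at hrec
      refine ih hl' _ h _ hFa (fun f hf => ?_) h256 (hdig _ (fun f hf => ?_) hFa) hrec
      · rw [hh f hf, add_assoc (a f)]
      · have := hh f hf
        have := h256 f hf
        omega

/-! ### Lower bound for the king grid -/

/-- The `5 × 5` square around the origin, which contains all neighbours of its neighbours. -/
noncomputable def kngBox : Finset (ℤ × ℤ) := Finset.Icc (-2) 2 ×ˢ Finset.Icc (-2) 2

theorem sum_kngBox (g : ℤ × ℤ → ℕ) :
    ∑ p ∈ kngBox, g p = g 0 + (searchSteps.map fun q => g q.cell).sum := by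
  have h1 : kngBox = (0 :: searchSteps.map SearchStep.cell).toFinset := by decide +kernel
  have h2 : (0 :: searchSteps.map SearchStep.cell).Nodup := by decide +kernel
  rw [h1, List.sum_toFinset _ h2, List.map_cons, List.sum_cons, List.map_map]
  rfl

theorem kngBox_filter_near : ∀ c ∈ kngCenters,
    (kngBox.filter fun p => kngNear c p) = kngNbr.image (c + ·) := by
  decide +kernel

theorem kngBox_filter_xor : ∀ i < 9, ∀ j < i,
    kngCenters.getD j 0 - kngCenters.getD i 0 ≠ 0 ∧
    (kngBox.filter fun p =>
      (kngNear (kngCenters.getD i 0) p ^^ kngNear (kngCenters.getD j 0) p) = true) =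
      (symmDiff kngNbr (kngNbr.image (kngCenters.getD j 0 - kngCenters.getD i 0 + ·))).image
        (kngCenters.getD i 0 + ·) := by
  decide +kernel

/-- The regions around a vertex `v` contain at least three detectors each, since they are
neighbourhoods and symmetric differences of two neighbourhoods. -/
theorem three_le_sum_region {S : Set (ℤ × ℤ)} (hS : IsErrOld KNG S) (v : ℤ × ℤ)
    {R : ℤ × ℤ → Bool} (hR : R ∈ kngRegions) :
    3 ≤ ∑ p ∈ kngBox.filter (R · = true), S.indicator (1 : ℤ × ℤ → ℕ) (v + p) := by
  obtain ⟨h1, h2⟩ := (gridNorm_kng.isErrOld_iff_sum mem_kngNbr S).1 hS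
  rw [kngRegions, List.mem_append] at hR
  rcases hR with hR | hR
  · obtain ⟨c, hc, rfl⟩ := List.mem_map.1 hR
    rw [kngBox_filter_near c hc, Finset.sum_image fun x _ y _ hxy => add_left_cancel hxy]
    simpa only [add_assoc] using h1 (v + c)
  · obtain ⟨i, hi, hR⟩ := List.mem_flatMap.1 hR
    obtain ⟨j, hj, rfl⟩ := List.mem_map.1 hR
    obtain ⟨hne, hf⟩ := kngBox_filter_xor i (List.mem_range.1 hi) j (List.mem_range.1 hj)
    rw [hf, Finset.sum_image fun x _ y _ hxy => add_left_cancel hxy]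
    simpa only [add_assoc] using h2 (v + kngCenters.getD i 0) _ hne

theorem sum_kngBox_cellVec {x : ℤ × ℤ → ℕ} {f : ℕ} (hf : f < 45) :
    ∑ p ∈ kngBox, x p * cellVec p f =
      ∑ p ∈ kngBox.filter (kngRegions.getD f (fun _ => false) · = true), x p := by
  rw [Finset.sum_filter]
  refine Finset.sum_congr rfl fun p _ => ?_
  rw [cellVec, if_pos hf]
  cases kngRegions.getD f (fun _ => false) p <;> simp

/-- The counter `45 + i` of the full configuration around `v` is the pattern around `v + kngDir i`,
read off from `v`. -/
theorem sum_kngBox_codeBit (s : ℤ × ℤ → ℕ) (v : ℤ × ℤ) (i : Fin 8) :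
    ∑ p ∈ kngBox, s (v + p) * cellVec p (45 + i) = kngCode s (v + kngDir i) (i + 4) := by
  have hmem : ∀ i j : Fin 8, kngDir i + kngDir (i + 4 + j) ∈ kngBox := by decide +kernel
  have hi : Fin.ofNat 8 (45 + (i : ℕ) - 45) = i := by
    rw [Nat.add_sub_cancel_left]
    exact Fin.ofNat_val_eq_self i
  simp only [cellVec, if_neg (by omega : ¬ 45 + (i : ℕ) < 45), hi, codeBit, Finset.mul_sum]
  rw [Finset.sum_comm, kngCode]
  refine Finset.sum_congr rfl fun j _ => ?_
  rw [Finset.sum_eq_single_of_mem _ (hmem i j)]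
  · rw [if_pos rfl, mul_one, mul_comm, add_assoc v]
  · intro p _ hp
    rw [if_neg hp.symm, mul_zero, mul_zero]

/-- Every detector receives at most 415 units. -/
theorem sum_share_le {S : Set (ℤ × ℤ)} (hS : IsErrOld KNG S) {v : ℤ × ℤ} (hv : v ∈ S) :
    ∑ i : Fin 8, kngShare i (kngCode (S.indicator 1) (v + kngDir i) (i + 4)) ≤ 415 := by
  set s : ℤ × ℤ → ℕ := S.indicator 1 with hs
  have hs1 : ∀ p, s p ≤ 1 := indicator_one_le_one S
  let F : ℕ → ℕ := fun f => ∑ p ∈ kngBox, s (v + p) * cellVec p f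
  have hcode : ∀ i : Fin 8, F (45 + i) = kngCode s (v + kngDir i) (i + 4) :=
    sum_kngBox_codeBit s v
  have hcount : ∀ i : Fin 8, F i = ∑ j, s (v + kngDir i + kngDir j) := by
    intro i
    have hreg : ∀ i : Fin 8, kngRegions.getD i (fun _ => false) = kngNear (kngDir i) ∧
        kngDir i ∈ kngCenters := by
      intro i
      fin_cases i <;> exact ⟨rfl, by decide⟩
    rw [← sum_kngNbr fun t => s (v + kngDir i + t)]
    show ∑ p ∈ kngBox, s (v + p) * cellVec p i = _
    rw [sum_kngBox_cellVec (by omega), (hreg i).1, kngBox_filter_near _ (hreg i).2,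
      Finset.sum_image fun x _ y _ hxy => add_left_cancel hxy]
    simp only [add_assoc]
  have hv0 : s (v + 0) = 1 := by simp [hs, hv]
  have hmain : ∑ i ∈ range 8, kngShare i (F (45 + i)) ≤ 415 := by
    refine search_sound (x := fun p => s (v + p)) (fun p => hs1 _) (F := F) (fun f hf => ?_)
      (fun i hi => ?_) searchSteps ?_ (cellVec 0)
      (fun f => (if f < 45 then 125 else 0) +
        (cellVec 0 f + (searchSteps.map fun p => cellVec p.cell f).sum)) 0 (fun f => ?_)
      (fun f _ => rfl) ?_ ?_ ?_
    · show 3 ≤ ∑ p ∈ kngBox, s (v + p) * cellVec p f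
      rw [sum_kngBox_cellVec hf]
      have hlen : f < kngRegions.length := hf
      rw [List.getD_eq_getElem _ _ hlen]
      exact three_le_sum_region hS v (List.getElem_mem hlen)
    · have h := hcode ⟨i, hi⟩
      have h' := hcount ⟨i, hi⟩
      rw [h, h']
      exact bitCount_kngCode hs1 _ _
    · exact ⟨by decide +kernel, by decide +kernel, by decide +kernel⟩
    · show ∑ p ∈ kngBox, s (v + p) * cellVec p f = _
      rw [sum_kngBox, hv0, one_mul]
    · decide +kernel
    · have hperm : (searchSteps.flatMap SearchStep.done).Perm (List.range 8) := by decide +kernel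
      rw [zero_add, (hperm.map _).sum_eq, ← List.sum_toFinset _ List.nodup_range,
        List.toFinset_range]
    · have e1 : pack 53 (cellVec 0) = 0x101010101010101010101010101010100000000000000000000000000000000000000000000000000000000000101010101010101 := by
        decide +kernel
      -- the counters when all cells contain detectors, with 125 added to the 45 counts
      have e2 : (pack 53 fun f => (if f < 45 then 125 else 0) +
          (cellVec 0 f + (searchSteps.map fun p => cellVec p.cell f).sum)) = 0xffffffffffffffff89858985898589858587898b8987858589898789898587898b8985898987858789858985858585858585858585 := by
        decide +kernel
      rw [e1, e2]
      exact search_eq_true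
  rw [← Fin.sum_univ_eq_sum_range fun i => kngShare i (F (45 + i))] at hmain
  simpa only [hcode] using hmain

/-- Each vertex sends the units `kngShare` to its neighbouring detectors; `180 / 415 = 36 / 83`. -/
theorem kng_count {S : Set (ℤ × ℤ)} (hS : IsErrOld KNG S) (v : ℤ × ℤ) (r : ℕ) :
    36 * (ball KNG v r).ncard ≤ 83 * (S ∩ ball KNG v (r + 1)).ncard := by
  have hs1 : ∀ p, S.indicator (1 : ℤ × ℤ → ℕ) p ≤ 1 := indicator_one_le_one S
  have h := gridNorm_kng.discharging S kngDir 1 (by decide)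
    (fun i u => S.indicator 1 (u + kngDir i) * kngShare i (kngCode (S.indicator 1) u i)) 180 415
    (fun u => le_sum_share hs1 u ?_) (fun w => ?_) v r
  · omega
  · rw [← sum_kngNbr fun t => S.indicator (1 : ℤ × ℤ → ℕ) (u + t)]
    exact ((gridNorm_kng.isErrOld_iff_sum mem_kngNbr S).1 hS).1 u
  · simp only [sub_add_cancel]
    rw [← Finset.mul_sum, mul_comm]
    by_cases hw : w ∈ S
    · refine Nat.mul_le_mul_right _ ?_
      rw [← Equiv.sum_comp (Equiv.addRight (4 : Fin 8))]
      have h1 : ∀ i, w - kngDir (i + 4) = w + kngDir i := by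
        intro i
        have : kngDir (i + 4) = -kngDir i := by revert i; decide
        rw [this, sub_neg_eq_add]
      have h2 : ∀ (i : Fin 8) (P : ℕ), kngShare ((i + 4 : Fin 8) : ℕ) P = kngShare i P := by
        intro i P
        have : ((i + 4 : Fin 8) : ℕ) % 2 = (i : ℕ) % 2 := by revert i; decide
        rw [kngShare, this, kngShare]
      simp only [Equiv.coe_addRight, h1, h2]
      exact sum_share_le hS hw
    · simp [hw]

end ErrOld

theorem mainTheorem6 (v : ℤ × ℤ) :
    ((6 / 7 : ℝ) ≤ ErrOld.errOldPercent ErrOld.SQR v ∧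
      ErrOld.errOldPercent ErrOld.SQR v ≤ (7 / 8 : ℝ) ∧
      ∃ S : Set (ℤ × ℤ), ErrOld.IsErrOld ErrOld.SQR S ∧
        ErrOld.density ErrOld.SQR v S = (7 / 8 : ℝ)) ∧
    ((6 / 11 : ℝ) ≤ ErrOld.errOldPercent ErrOld.TRI v ∧
      ErrOld.errOldPercent ErrOld.TRI v ≤ (4 / 7 : ℝ) ∧
      ∃ S : Set (ℤ × ℤ), ErrOld.IsErrOld ErrOld.TRI S ∧
        ErrOld.density ErrOld.TRI v S = (4 / 7 : ℝ)) ∧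
    ((36 / 83 : ℝ) ≤ ErrOld.errOldPercent ErrOld.KNG v ∧
      ErrOld.errOldPercent ErrOld.KNG v ≤ (4 / 9 : ℝ) ∧
      ∃ S : Set (ℤ × ℤ), ErrOld.IsErrOld ErrOld.KNG S ∧
        ErrOld.density ErrOld.KNG v S = (4 / 9 : ℝ)) := by
  have hs := ErrOld.gridNorm_sqr.errOldPercent_bounds (v := v) (a := 6) (b := 7) (by norm_num) 2
    (fun S hS => ErrOld.sqr_count hS v) ErrOld.isErrOld_sqrPattern
  have ht := ErrOld.gridNorm_tri.errOldPercent_bounds (v := v) (a := 6) (b := 11) (by norm_num) 1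
    (fun S hS => ErrOld.tri_count hS v) ErrOld.isErrOld_triPattern
  have hk := ErrOld.gridNorm_kng.errOldPercent_bounds (v := v) (a := 36) (b := 83) (by norm_num) 1
    (fun S hS => ErrOld.kng_count hS v) ErrOld.isErrOld_kngPattern
  rw [ErrOld.density_sqrPattern] at hs
  rw [ErrOld.density_triPattern] at ht
  rw [ErrOld.density_kngPattern] at hk
  exact ⟨⟨by simpa using hs.1, hs.2, _, ErrOld.isErrOld_sqrPattern, ErrOld.density_sqrPattern v⟩,
    ⟨by simpa using ht.1, ht.2, _, ErrOld.isErrOld_triPattern, ErrOld.density_triPattern v⟩,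
    ⟨by simpa using hk.1, hk.2, _, ErrOld.isErrOld_kngPattern, ErrOld.density_kngPattern v⟩⟩
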